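/- Let $p>1$, $p'=\frac{p}{p-1}$ and $\theta\in(0,1)$. Let $D\in C^1(0,1)$ with $D>0$ on $(0,1)$ (possibly degenerate or singular at $0$ and $1$), let $h\in C[0,1]$, $H(u)=\int_0^u h(s)\,ds$, $h_m=\min_{[0,1]}h$, and let $g\in C[0,1]$ satisfy $g=0$ on $[0,\theta]$, $g>0$ on $(\theta,1)$, $g(1)=0$. Assume $\int_0^1 D^{p'-1}(u)g(u)\,du<+\infty$. For $c\in\mathbb R$ consider $$\left(D(u)|u'|^{p-2}u'\right)'+(c+h(u))u'+g(u)=0,\qquad u(-\infty)=1,\quad u(+\infty)=0. \tag{1}$$ A solution of (1) is a continuous function $u:\mathbb R\to[0,1]$ such that, with $I_u=\{\xi: 0<u(\xi)<1\}$: (a) $u\in C^1(I_u)$ and the equation holds at every point of $I_u$; (b) the function $\xi\mapsto D(u(\xi))|u'(\xi)|^{p-2}u'(\xi)$, taken to be $0$ where $u\in\{0,1\}$, is continuous on $\mathbb R$ and tends to $0$ as $u(\xi)\to0$ and as $u(\xi)\to1$; (c) $u(\xi)\to1$ as $\xi\to-\infty$ and $u(\xi)\to0$ as $\xi\to+\infty$.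 Let $$k(p)=\begin{cases}\dfrac1{2^{p'-1}-1}&\text{if }1<p<2,\\ 1&\text{if }p=2,\\ \dfrac{p'}{p'-1+\dfrac{1+p'(p'-1)^{\frac1{p'-2}}+(p'-1)^{\frac{p'}{p'-2}}}{\left(1+(p'-1)^{\frac1{p'-2}}\right)^{p'}}}&\text{if }p>2.\end{cases}$$ Theorem. Suppose $h(u)>0$ for all $u\in[0,1]$ and $$H(1)\le\left(k(p)\int_0^1 D^{p'-1}(u)g(u)\,du\right)^{1/p'}.$$ Then there is a unique $c=c^*\in\mathbb R$ for which (1) has a solution; for $c=c^*$ the solution is unique up to translation; and $c^*>0>-h_m$. -/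

import Mathlib

open Set Filter Topology

noncomputable section

namespace TravelingWave

/-- The conjugate exponent `p' = p / (p - 1)`. -/
def conj (p : ℝ) : ℝ := p / (p - 1)

/-- The convective flux `H(u) = ∫₀ᵘ h(s) ds` with convective velocity `h`. -/
def convFlux (h : ℝ → ℝ) (u : ℝ) : ℝ := ∫ s in (0 : ℝ)..u, h s

/-- The minimum `h_m` of `h` over `[0,1]`; it is attained whenever `h` is continuous on `[0,1]`. -/
def hMin (h : ℝ → ℝ) : ℝ := sInf (h '' Icc (0 : ℝ) 1)

/-- The constant `k(p)`, `p > 1`. -/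
def kConst (p : ℝ) : ℝ :=
  if p < 2 then 1 / ((2 : ℝ) ^ (conj p - 1) - 1)
  else if p = 2 then 1
  else
    conj p /
      (conj p - 1 +
        (1 + conj p * (conj p - 1) ^ (1 / (conj p - 2))
            + (conj p - 1) ^ (conj p / (conj p - 2))) /
          (1 + (conj p - 1) ^ (1 / (conj p - 2))) ^ conj p)

/-- The set `I_u` on which the profile lies strictly between the two equilibria. -/
def interiorSet (u : ℝ → ℝ) : Set ℝ := {ξ | 0 < u ξ ∧ u ξ < 1}

/-- The diffusive flux `ξ ↦ D(u(ξ)) |u'(ξ)|^(p-2) u'(ξ)`. The coefficient `D` is only given on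
`(0,1)`; where `u` equals `0` or `1` the flux has the value `0`
(there `u'(ξ)`, if it exists, vanishes, since `u` has values in `[0,1]`). -/
def diffFlux (p : ℝ) (D u : ℝ → ℝ) : ℝ → ℝ :=
  (interiorSet u).indicator fun ξ => D (u ξ) * |deriv u ξ| ^ (p - 2) * deriv u ξ

/-- `u` is a (possibly non-smooth) solution of
`(D(u) |u'|^(p-2) u')' + (c + h(u)) u' + g(u) = 0`, `u(-∞) = 1`, `u(+∞) = 0`. -/
structure IsProfile (p : ℝ) (D h g : ℝ → ℝ) (c : ℝ) (u : ℝ → ℝ) : Prop where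
  mem_Icc : ∀ ξ, u ξ ∈ Icc (0 : ℝ) 1
  continuous : Continuous u
  contDiffOn : ContDiffOn ℝ 1 u (interiorSet u)
  equation : ∀ ξ ∈ interiorSet u,
    DifferentiableAt ℝ (diffFlux p D u) ξ ∧
      deriv (diffFlux p D u) ξ + (c + h (u ξ)) * deriv u ξ + g (u ξ) = 0
  flux_continuous : Continuous (diffFlux p D u)
  /-- the flux tends to `0` as `u(ξ) → 0` -/
  flux_zero : Tendsto (diffFlux p D u) (comap u (𝓝 0)) (𝓝 0)
  /-- the flux tends to `0` as `u(ξ) → 1` -/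
  flux_one : Tendsto (diffFlux p D u) (comap u (𝓝 1)) (𝓝 0)
  tendsto_atBot : Tendsto u atBot (𝓝 1)
  tendsto_atTop : Tendsto u atTop (𝓝 0)

/-- `c` is the unique wave speed: there is a profile for the speed `c`, it is unique up to
translation, and no other real speed admits a profile. -/
structure IsUniqueWaveSpeed (p : ℝ) (D h g : ℝ → ℝ) (c : ℝ) : Prop where
  exists_profile : ∃ u, IsProfile p D h g c u
  profile_unique : ∀ u v, IsProfile p D h g c u → IsProfile p D h g c v →
    ∃ τ : ℝ, ∀ ξ, v ξ = u (ξ + τ)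
  speed_unique : ∀ c' u, IsProfile p D h g c' u → c' = c

end TravelingWave

end

/-! Take the concentration as the independent variable. Along a decreasing front, minus the
diffusive flux is a function `V` of the level with `V(0) = V(1) = 0`, `V > 0` in between and `V' = c
+ h - D^(p'-1) g V^(1-p')`. Since `g = 0` on `[0,θ]`, there `V(s) = c s + H(s)`. On `[θ,1]` the
power `y = V^p'` solves `y' = p'((c + h) y^((p'-1)/p') - D^(p'-1) g)` backward from `y(1) = 0`. The
power of `y` is not Lipschitz at `0`, but it is increasing and `c + h > 0` for `c ≥ 0`, so the
backward problem is stable (`abs_sub_le_of_monotone`, `Coeffs.exists_powerFlux`) and `y(θ)` is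
Lipschitz in `c`.

The speed is a root of `y(θ)^(1/p') = c θ + H(θ)`. For large `c` the right side wins, because `y ≤
p' ∫ D^(p'-1) g`. At `c = 0` the left side wins (`Coeffs.convFlux_lt_of_speed_zero`): otherwise `V ≤
H` on `[θ,1]`, and integrating the equation for `y` gives `p' ∫ D^(p'-1) g ≤ H(1)^p'`. This
contradicts `H(1)^p' ≤ ∫ D^(p'-1) g`, which follows from the assumption because `k(p) ≤ 1`.
Inverting the arrival time turns `V` into a profile (`isProfile_profileOf`).

Uniqueness does not presuppose monotone profiles. For a profile of speed `b`, the total flux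
(diffusive flux plus `b u + H(u)`) is nonincreasing in `ξ`; this forces strict decrease above `θ`
and zero total flux once `θ` is reached. The gap between `V(u)` and minus the diffusive flux starts
from `0` at `-∞`; following its sign down to the level `θ` gives `b = c` (`IsProfile.speed_eq`),
then equality of fluxes, and finally a translate (`IsProfile.exists_translation`). -/

namespace TravelingWave

/-! ### One-variable comparison principles -/

/-- A function that grows at rate at most `κ` wherever it exceeds `m` stays below the line of slope
`κ` issued from `m`. -/
theorem le_add_of_deriv_le_above {w : ℝ → ℝ} {a b m κ : ℝ} (hab : a ≤ b) (hκ : 0 ≤ κ)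
    (hw : ContinuousOn w (Icc a b)) (ha : w a ≤ m)
    (hd : ∀ x ∈ Ioo a b, m < w x → ∃ w', HasDerivAt w w' x ∧ w' ≤ κ) :
    w b ≤ m + κ * (b - a) := by
  -- `s` is the last point with `w ≤ m`; beyond it the slope bound holds without exception.
  obtain ⟨s, ⟨hs, hsm⟩, hmax⟩ : ∃ s, IsGreatest (Icc a b ∩ w ⁻¹' Iic m) s :=
    (isCompact_Icc.of_isClosed_subset (hw.preimage_isClosed_of_isClosed isClosed_Icc isClosed_Iic)
      inter_subset_left).exists_isGreatest ⟨a, left_mem_Icc.2 hab, ha⟩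
  have hd' : ∀ x ∈ Ioo s b, ∃ w', HasDerivAt w w' x ∧ w' ≤ κ := fun x hx =>
    hd x ⟨hs.1.trans_lt hx.1, hx.2⟩ <| by
      by_contra! hle
      exact hx.1.not_ge (hmax ⟨⟨(hs.1.trans_lt hx.1).le, hx.2.le⟩, hle⟩)
  have h := (convex_Icc s b).image_sub_le_mul_sub_of_deriv_le (f := w) (C := κ)
    (hw.mono (Icc_subset_Icc_left hs.1))
    (by
      rw [interior_Icc]
      intro x hx
      obtain ⟨w', h1, -⟩ := hd' x hx
      exact h1.differentiableAt.differentiableWithinAt)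
    (by
      rw [interior_Icc]
      intro x hx
      obtain ⟨w', h1, h2⟩ := hd' x hx
      rwa [h1.deriv])
    s (left_mem_Icc.2 hs.2) b (right_mem_Icc.2 hs.2) hs.2
  have hsm' : w s ≤ m := hsm
  have : κ * (b - s) ≤ κ * (b - a) := mul_le_mul_of_nonneg_left (by linarith [hs.1]) hκ
  linarith

/-- The time-reversed form of `le_add_of_deriv_le_above`. -/
theorem le_add_of_le_deriv_above {w : ℝ → ℝ} {a b m κ : ℝ} (hab : a ≤ b) (hκ : 0 ≤ κ)
    (hw : ContinuousOn w (Icc a b)) (hb : w b ≤ m)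
    (hd : ∀ x ∈ Ioo a b, m < w x → ∃ w', HasDerivAt w w' x ∧ -κ ≤ w') :
    w a ≤ m + κ * (b - a) := by
  have h := le_add_of_deriv_le_above (w := fun x => w (-x)) (a := -b) (b := -a) (m := m)
    (neg_le_neg hab) hκ
    (hw.comp continuous_neg.continuousOn fun x hx => ⟨by linarith [hx.2], by linarith [hx.1]⟩)
    (by simpa using hb)
    (fun x hx hx' => by
      obtain ⟨w', h1, h2⟩ := hd (-x) ⟨by linarith [hx.2], by linarith [hx.1]⟩ hx'
      refine ⟨-w', ?_, by linarith⟩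
      have h3 := h1.scomp x (hasDerivAt_neg x)
      rw [neg_one_smul] at h3
      exact h3)
  simp only [neg_neg] at h
  linarith

/-- A continuous function with nonpositive derivative away from finitely many of its values does
not increase. -/
theorem le_of_deriv_nonpos_of_finite_values {E : ℝ → ℝ} {a b : ℝ} {S : Set ℝ} (hS : S.Finite)
    (hab : a ≤ b) (hE : ContinuousOn E (Icc a b))
    (hd : ∀ x ∈ Ioo a b, E x ∉ S → ∃ E', HasDerivAt E E' x ∧ E' ≤ 0) : E b ≤ E a := by
  by_contra! hlt
  -- A window of values `[y, y + ε)` avoids `S`. Up to the first time `β` at which `E` reaches `y +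
  -- ε/2`, every value above `y` lies in this window, so `E` cannot have risen from below `y`.
  obtain ⟨y, hy, hyS⟩ := (Ioo_infinite hlt).exists_notMem_finite hS
  obtain ⟨ε, hε, hball⟩ := Metric.isOpen_iff.1
    (isOpen_Ioo.sdiff hS.isClosed : IsOpen (Ioo (E a) (E b) \ S)) y ⟨hy, hyS⟩
  have hmem : ∀ z, y ≤ z → z < y + ε → z ∈ Ioo (E a) (E b) \ S := fun z h1 h2 =>
    hball (by rw [Metric.mem_ball, Real.dist_eq, abs_of_nonneg (by linarith)]; linarith)
  have hy2 := hmem (y + ε / 2) (by linarith) (by linarith)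
  obtain ⟨β, ⟨hβ, hβy⟩, hmin⟩ : ∃ s, IsLeast (Icc a b ∩ E ⁻¹' Ici (y + ε / 2)) s :=
    (isCompact_Icc.of_isClosed_subset (hE.preimage_isClosed_of_isClosed isClosed_Icc isClosed_Ici)
      inter_subset_left).exists_isLeast ⟨b, right_mem_Icc.2 hab, hy2.1.2.le⟩
  have h := le_add_of_deriv_le_above (m := y) (κ := 0) hβ.1 le_rfl
    (hE.mono (Icc_subset_Icc_right hβ.2)) hy.1.le (fun x hx hx' =>
      hd x ⟨hx.1, hx.2.trans_le hβ.2⟩ (hmem _ hx'.le (by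
        by_contra! hle
        exact hx.2.not_ge (hmin ⟨⟨hx.1.le, (hx.2.trans_le hβ.2).le⟩,
          show y + ε / 2 ≤ E x by linarith⟩))).2)
  have : y + ε / 2 ≤ E β := hβy
  linarith

/-! ### Scalar equations with a monotone nonlinearity -/

section ODE

variable {a b z₀ : ℝ} {k A ρ : ℝ → ℝ}

/-- Picard–Lindelöf with the initial time at the right endpoint. As `ρ` is bounded, a ball of radius
`sup |k| · B · (b - a)` is never left, so the solution covers the whole interval. -/
theorem exists_backward_solution_of_lipschitz {B : ℝ} {K : NNReal} (hab : a ≤ b)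
    (hk : ContinuousOn k (Icc a b)) (hA : ContinuousOn A (Icc a b)) (hρ : LipschitzWith K ρ)
    (hB : ∀ s, |ρ s| ≤ B) (z₀ : ℝ) :
    ∃ z : ℝ → ℝ, ContinuousOn z (Icc a b) ∧ z b = z₀ ∧
      ∀ x ∈ Ioo a b, HasDerivAt z (k x * ρ (z x - A x)) x := by
  obtain ⟨k₁, hk₁⟩ := isCompact_Icc.exists_bound_of_continuousOn hk
  have hB0 : 0 ≤ B := (abs_nonneg _).trans (hB 0)
  have hk0 : 0 ≤ k₁ := (norm_nonneg _).trans (hk₁ a (left_mem_Icc.2 hab))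
  lift B to NNReal using hB0
  lift k₁ to NNReal using hk0
  have hPL : IsPicardLindelof (fun x z => k x * ρ (z - A x)) (⟨b, right_mem_Icc.2 hab⟩ : Icc a b)
      z₀ (k₁ * B * (b - a).toNNReal) 0 (k₁ * B) (k₁ * K) := by
    refine ⟨fun t ht => ?_, fun z _ => ?_, fun t ht z _ => ?_, ?_⟩
    · refine LipschitzWith.lipschitzOnWith (LipschitzWith.of_dist_le_mul fun z z' => ?_)
      have h1 := hρ.dist_le_mul (z - A t) (z' - A t)
      rw [dist_sub_right] at h1
      rw [Real.dist_eq, ← mul_sub, abs_mul, ← Real.dist_eq (ρ _)]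
      push_cast
      rw [mul_assoc]
      exact mul_le_mul (hk₁ t ht) h1 dist_nonneg k₁.2
    · exact hk.mul (hρ.continuous.comp_continuousOn (continuousOn_const.sub hA))
    · rw [norm_mul]
      exact mul_le_mul (hk₁ t ht) (hB _) (norm_nonneg _) k₁.2
    · simp [hab]
  obtain ⟨z, hz0, hz⟩ := hPL.exists_eq_forall_mem_Icc_hasDerivWithinAt₀
  exact ⟨z, fun x hx => (hz x hx).continuousWithinAt, hz0, fun x hx =>
    (hz x (Ioo_subset_Icc_self hx)).hasDerivAt (Icc_mem_nhds hx.1 hx.2)⟩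

/-- Continuous dependence on the nonlinearity, when one of the two is monotone. -/
theorem abs_sub_le_of_monotone {ρ' z z' : ℝ → ℝ} {κ δ : ℝ} (hδ : 0 ≤ δ)
    (hk0 : ∀ x ∈ Icc a b, 0 ≤ k x) (hk : ∀ x ∈ Icc a b, k x ≤ κ)
    (hρ : Monotone ρ) (hρ' : ∀ s, |ρ s - ρ' s| ≤ δ)
    (hz : ContinuousOn z (Icc a b)) (hz' : ContinuousOn z' (Icc a b)) (hb : z b = z' b)
    (hd : ∀ x ∈ Ioo a b, HasDerivAt z (k x * ρ (z x - A x)) x)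
    (hd' : ∀ x ∈ Ioo a b, HasDerivAt z' (k x * ρ' (z' x - A x)) x) :
    ∀ x ∈ Icc a b, |z x - z' x| ≤ κ * δ * (b - a) := by
  intro x hx
  have hκ : 0 ≤ κ := (hk0 x hx).trans (hk x hx)
  have key : ∀ y ∈ Icc a b, k y * δ ≤ κ * δ := fun y hy => mul_le_mul_of_nonneg_right (hk y hy) hδ
  have hle : κ * δ * (b - x) ≤ κ * δ * (b - a) :=
    mul_le_mul_of_nonneg_left (by linarith [hx.1]) (by positivity)
  have sub : Icc x b ⊆ Icc a b := Icc_subset_Icc_left hx.1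
  -- Where `z > z'`, monotonicity of `ρ` makes the gap shrink backward in `x`; only the discrepancy
  -- `k δ` between the nonlinearities can enlarge it.
  have h1 := le_add_of_le_deriv_above (w := fun y => z y - z' y) (m := 0) (κ := κ * δ) hx.2
    (by positivity) ((hz.sub hz').mono sub) (by simp [hb]) (fun y hy hy' => by
      have hyo : y ∈ Ioo a b := ⟨hx.1.trans_lt hy.1, hy.2⟩
      have hyI := Ioo_subset_Icc_self hyo
      refine ⟨_, (hd y hyo).sub (hd' y hyo), ?_⟩
      have e1 : ρ (z' y - A y) ≤ ρ (z y - A y) := hρ (by linarith)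
      have e2 := (abs_le.1 (hρ' (z' y - A y))).1
      have : k y * -δ ≤ k y * (ρ (z y - A y) - ρ' (z' y - A y)) :=
        mul_le_mul_of_nonneg_left (by linarith) (hk0 y hyI)
      linarith [key y hyI])
  have h2 := le_add_of_le_deriv_above (w := fun y => z' y - z y) (m := 0) (κ := κ * δ) hx.2
    (by positivity) ((hz'.sub hz).mono sub) (by simp [hb]) (fun y hy hy' => by
      have hyo : y ∈ Ioo a b := ⟨hx.1.trans_lt hy.1, hy.2⟩
      have hyI := Ioo_subset_Icc_self hyo
      refine ⟨_, (hd' y hyo).sub (hd y hyo), ?_⟩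
      have e1 : ρ (z y - A y) ≤ ρ (z' y - A y) := hρ (by linarith)
      have e2 := (abs_le.1 (hρ' (z' y - A y))).2
      have : k y * -δ ≤ k y * (ρ' (z' y - A y) - ρ (z y - A y)) :=
        mul_le_mul_of_nonneg_left (by linarith) (hk0 y hyI)
      linarith [key y hyI])
  rw [abs_le]
  constructor <;> linarith

/-- Backward solvability of `z' = k(x) ρ(z - A(x))` for a bounded monotone `ρ` that is a uniform
limit of Lipschitz monotone functions. -/
theorem exists_backward_solution {B : ℝ} (hab : a ≤ b)
    (hk : ContinuousOn k (Icc a b)) (hk0 : ∀ x ∈ Icc a b, 0 ≤ k x)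
    (hA : ContinuousOn A (Icc a b)) (hρu : UniformContinuous ρ)
    (hB : ∀ s, |ρ s| ≤ B)
    (happ : ∀ ε > 0, ∃ ρ' : ℝ → ℝ, Monotone ρ' ∧ (∃ K, LipschitzWith K ρ') ∧
      ∀ s, |ρ' s - ρ s| ≤ ε) (z₀ : ℝ) :
    ∃ z : ℝ → ℝ, ContinuousOn z (Icc a b) ∧ z b = z₀ ∧
      ∀ x ∈ Ioo a b, HasDerivAt z (k x * ρ (z x - A x)) x := by
  obtain ⟨κ, hκ⟩ := isCompact_Icc.exists_bound_of_continuousOn hk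
  have hκ' : ∀ x ∈ Icc a b, k x ≤ κ := fun x hx => (le_abs_self _).trans (hκ x hx)
  have hκ0 : 0 ≤ κ := (norm_nonneg _).trans (hκ a (left_mem_Icc.2 hab))
  have hε : ∀ n : ℕ, (0 : ℝ) < 1 / ((n : ℝ) + 1) := fun n => Nat.one_div_pos_of_nat
  choose ρn hmono hlip hnear using fun n : ℕ => happ _ (hε n)
  choose K hK using hlip
  have hBn : ∀ n s, |ρn n s| ≤ B + 1 / ((n : ℝ) + 1) := fun n s => by
    have := abs_add_le (ρn n s - ρ s) (ρ s)
    rw [sub_add_cancel] at this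
    linarith [hnear n s, hB s]
  choose zn hzc hzb hzd using fun n =>
    exists_backward_solution_of_lipschitz hab hk hA (hK n) (hBn n) z₀
  have hcmp : ∀ n m, ∀ x ∈ Icc a b, |zn n x - zn m x| ≤
      κ * (1 / ((n : ℝ) + 1) + 1 / ((m : ℝ) + 1)) * (b - a) := fun n m =>
    abs_sub_le_of_monotone (add_nonneg (hε n).le (hε m).le) hk0 hκ' (hmono n)
      (fun s => by
        have h1 := hnear n s
        have h2 := hnear m s
        rw [abs_le] at *
        constructor <;> linarith)
      (hzc n) (hzc m) ((hzb n).trans (hzb m).symm) (hzd n) (hzd m)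
  have hlim0 : Tendsto (fun n : ℕ => 1 / ((n : ℝ) + 1)) atTop (𝓝 0) :=
    tendsto_one_div_add_atTop_nhds_zero_nat
  have hcau : UniformCauchySeqOn zn atTop (Icc a b) := by
    rw [Metric.uniformCauchySeqOn_iff]
    intro ε hεp
    have : Tendsto (fun n : ℕ => κ * (1 / ((n : ℝ) + 1) + 1 / ((n : ℝ) + 1)) * (b - a)) atTop
        (𝓝 (κ * (0 + 0) * (b - a))) := ((hlim0.add hlim0).const_mul κ).mul_const _
    obtain ⟨N, hN⟩ := (this.eventually (gt_mem_nhds (by simpa using hεp))).exists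
    refine ⟨N, fun m hm n hn x hx => (hcmp m n x hx).trans_lt (lt_of_le_of_lt ?_ hN)⟩
    have := sub_nonneg.2 hab
    gcongr
  have hpt : ∀ x ∈ Icc a b, ∃ l, Tendsto (fun n => zn n x) atTop (𝓝 l) := fun x hx =>
    cauchySeq_tendsto_of_complete (hcau.cauchySeq hx)
  choose! z hz using hpt
  have hunif : TendstoUniformlyOn zn z atTop (Icc a b) := hcau.tendstoUniformlyOn_of_tendsto hz
  refine ⟨z, hunif.continuousOn (Frequently.of_forall hzc), ?_, fun x hx => ?_⟩
  · exact tendsto_nhds_unique (hz b (right_mem_Icc.2 hab)) (by simp [hzb])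
  -- The derivatives converge uniformly too: half of the error comes from the uniform continuity of
  -- `ρ`, half from `ρn - ρ`.
  refine hasDerivAt_of_tendstoUniformlyOn isOpen_Ioo (f := zn) (l := atTop)
    (f' := fun n x => k x * ρn n (zn n x - A x)) (g' := fun x => k x * ρ (z x - A x))
    ?_ (.of_forall hzd) (fun y hy => hz y (Ioo_subset_Icc_self hy)) hx
  rw [Metric.tendstoUniformlyOn_iff]
  intro ε hεp
  obtain ⟨δ, hδ, hρδ⟩ := Metric.uniformContinuous_iff.1 hρu (ε / (2 * (κ + 1))) (by positivity)
  filter_upwards [Metric.tendstoUniformlyOn_iff.1 hunif δ hδ,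
    hlim0.eventually (gt_mem_nhds (show 0 < ε / (2 * (κ + 1)) by positivity))] with n h1 h2 y hy
  have hyI := Ioo_subset_Icc_self hy
  have h3 := hρδ (a := z y - A y) (b := zn n y - A y) (by rw [dist_sub_right]; exact h1 y hyI)
  have h4 := hnear n (zn n y - A y)
  rw [Real.dist_eq] at h3 ⊢
  rw [← mul_sub, abs_mul]
  have h5 : |ρ (z y - A y) - ρn n (zn n y - A y)| < ε / (κ + 1) := by
    have : ε / (κ + 1) = ε / (2 * (κ + 1)) + ε / (2 * (κ + 1)) := by field_simp; norm_num
    rw [this]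
    rw [abs_lt] at h3 ⊢
    rw [abs_le] at h4
    constructor <;> linarith
  calc |k y| * |ρ (z y - A y) - ρn n (zn n y - A y)| ≤ κ * (ε / (κ + 1)) :=
        mul_le_mul (hκ y hyI) h5.le (abs_nonneg _) hκ0
    _ < ε := by
        rw [mul_div_assoc', div_lt_iff₀ (by positivity)]
        nlinarith

end ODE

/-! ### Exponents and the constant `k(p)` -/

theorem one_lt_conj {p : ℝ} (hp : 1 < p) : 1 < conj p := by
  rw [conj, one_lt_div (by linarith)]
  linarith

theorem conj_sub_one_mul {p : ℝ} (hp : 1 < p) : (conj p - 1) * (p - 1) = 1 := by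
  have : p - 1 ≠ 0 := by linarith
  rw [conj]
  field_simp
  ring

/-- Both sides agree at `a = 0`, and the derivatives compare because `x ↦ x^(q-1)` is subadditive
for `0 ≤ q - 1 ≤ 1`. -/
theorem one_add_rpow_le {a q : ℝ} (ha : 0 ≤ a) (hq1 : 1 ≤ q) (hq2 : q ≤ 2) :
    (1 + a) ^ q ≤ 1 + q * a + a ^ q := by
  have h := le_add_of_deriv_le_above (w := fun x => (1 + x) ^ q - (1 + q * x + x ^ q))
    (a := 0) (b := a) (m := 0) (κ := 0) ha le_rfl
    (by
      refine ContinuousOn.sub ?_ ?_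
      · exact ((continuous_const.add continuous_id).rpow_const fun _ => Or.inr (by linarith))
          |>.continuousOn
      · exact ((continuous_const.add (continuous_const.mul continuous_id)).add
          (continuous_id.rpow_const fun _ => Or.inr (by linarith))).continuousOn)
    (by simp [Real.zero_rpow (by linarith : q ≠ 0)])
    (fun x hx _ => by
      have hx0 : 0 < x := hx.1
      refine ⟨_, ((((hasDerivAt_id x).const_add 1).rpow_const (p := q) (Or.inr hq1)).sub
        ((((hasDerivAt_id x).const_mul q).const_add 1).add
          ((hasDerivAt_id x).rpow_const (p := q) (Or.inr hq1)))), ?_⟩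
      have h1 := Real.rpow_add_le_add_rpow (p := q - 1) zero_le_one hx0.le (by linarith)
        (by linarith)
      rw [Real.one_rpow] at h1
      simp only [id]
      nlinarith)
  simp only [zero_mul, add_zero] at h
  linarith

/-- The only information about `k(p)` that the existence proof needs. For `p > 2`, with `a =
(p'-1)^(1/(p'-2))`, the inner quotient is `(1 + p' a + a^p')/(1 + a)^p' ≥ 1`, so the denominator is
at least `p'`. -/
theorem kConst_nonneg_and_le_one {p : ℝ} (hp : 1 < p) : 0 ≤ kConst p ∧ kConst p ≤ 1 := by
  have hq := one_lt_conj hp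
  have hqp := conj_sub_one_mul hp
  rw [kConst]
  split_ifs with h1 h2
  · have h2 : 1 ≤ conj p - 1 := by
      by_contra! hlt
      nlinarith
    have h3 : (2 : ℝ) ≤ 2 ^ (conj p - 1) := by
      simpa using Real.rpow_le_rpow_of_exponent_le (one_le_two : (1 : ℝ) ≤ 2) h2
    have h4 : (1 : ℝ) ≤ 2 ^ (conj p - 1) - 1 := by linarith
    exact ⟨by positivity, (div_le_one (by linarith)).2 h4⟩
  · exact ⟨zero_le_one, le_rfl⟩
  · have hp2 : 2 < p := lt_of_le_of_ne (not_lt.1 h1) (Ne.symm h2)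
    have hq2 : conj p - 1 ≤ 1 := by
      by_contra! hlt
      nlinarith
    set q := conj p
    set a := (q - 1) ^ (1 / (q - 2)) with ha
    have hq1 : 0 < q - 1 := by linarith
    have ha0 : 0 < a := Real.rpow_pos_of_pos hq1 _
    have haq : (q - 1) ^ (q / (q - 2)) = a ^ q := by
      rw [ha, ← Real.rpow_mul hq1.le]
      congr 1
      ring
    rw [haq]
    have h3 := one_add_rpow_le ha0.le hq.le (by linarith)
    have h4 : 0 < (1 + a) ^ q := by positivity
    have h5 : 1 ≤ (1 + q * a + a ^ q) / (1 + a) ^ q := (one_le_div h4).2 h3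
    have h6 : 0 < q - 1 + (1 + q * a + a ^ q) / (1 + a) ^ q := by linarith
    exact ⟨div_nonneg (by linarith) h6.le, (div_le_one h6).2 (by linarith)⟩

/-! ### Truncated powers -/

theorem rpow_clamp_le {e M : ℝ} (he : 0 ≤ e) (hM : 0 ≤ M) (s : ℝ) :
    |(max 0 (min M s)) ^ e| ≤ M ^ e := by
  have h0 : 0 ≤ max 0 (min M s) := le_max_left _ _
  rw [abs_of_nonneg (Real.rpow_nonneg h0 _)]
  exact Real.rpow_le_rpow h0 (max_le hM (min_le_left _ _)) he

theorem lipschitzWith_clamp {M : ℝ} (hM : 0 ≤ M) :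
    LipschitzWith 1 fun s : ℝ => max 0 (min M s) := by
  have h := (LipschitzWith.subtype_val (Icc 0 M)).comp (LipschitzWith.projIcc hM)
  rw [one_mul] at h
  exact h

theorem uniformContinuous_rpow_clamp {e M : ℝ} (he : 0 ≤ e) (hM : 0 ≤ M) :
    UniformContinuous fun s : ℝ => (max 0 (min M s)) ^ e := by
  have h1 : UniformContinuous fun s : Icc (0 : ℝ) M => (s : ℝ) ^ e :=
    CompactSpace.uniformContinuous_of_continuous
      ((Real.continuous_rpow_const he).comp continuous_subtype_val)
  exact h1.comp (LipschitzWith.projIcc hM).uniformContinuous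

/-- Shifting the base by `ε^(1/e)` keeps it away from the singular point `0`; by subadditivity of
the power the shift costs at most `(ε^(1/e))^e = ε`. -/
theorem exists_lipschitz_near_rpow_clamp {e M ε : ℝ} (he : 0 < e) (he1 : e ≤ 1) (hM : 0 ≤ M)
    (hε : 0 < ε) :
    ∃ ρ : ℝ → ℝ, Monotone ρ ∧ (∃ K, LipschitzWith K ρ) ∧
      ∀ s, |ρ s - (max 0 (min M s)) ^ e| ≤ ε := by
  have hδ : 0 < ε ^ e⁻¹ := Real.rpow_pos_of_pos hε _
  have h0 : ∀ s, 0 ≤ max 0 (min M s) := fun s => le_max_left _ _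
  refine ⟨fun s => (ε ^ e⁻¹ + max 0 (min M s)) ^ e, fun s t hst => ?_,
    ⟨Real.toNNReal (e * (ε ^ e⁻¹) ^ (e - 1)) * 1, ?_⟩, fun s => ?_⟩
  · refine Real.rpow_le_rpow (add_nonneg hδ.le (h0 s)) ?_ he.le
    gcongr
  · have h1 : LipschitzOnWith (Real.toNNReal (e * (ε ^ e⁻¹) ^ (e - 1))) (fun x : ℝ => x ^ e)
        (Ici (ε ^ e⁻¹)) := by
      refine (convex_Ici _).lipschitzOnWith_of_nnnorm_hasDerivWithin_le
        (f' := fun x => e * x ^ (e - 1)) (fun x hx => ?_) (fun x hx => ?_)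
      · exact (Real.hasDerivAt_rpow_const (Or.inl (hδ.trans_le hx).ne')).hasDerivWithinAt
      · have hx0 : 0 < x := hδ.trans_le hx
        rw [← NNReal.coe_le_coe, coe_nnnorm, Real.coe_toNNReal _ (by positivity),
          Real.norm_of_nonneg (by positivity)]
        exact mul_le_mul_of_nonneg_left (Real.rpow_le_rpow_of_nonpos hδ hx (by linarith)) he.le
    have h2 : LipschitzWith 1 fun s => ε ^ e⁻¹ + max 0 (min M s) := by
      refine LipschitzWith.of_dist_le_mul fun s t => ?_
      rw [dist_add_left]
      exact (lipschitzWith_clamp hM).dist_le_mul s t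
    rw [← lipschitzOnWith_univ] at h2 ⊢
    exact h1.comp h2 fun s _ => le_add_of_nonneg_right (h0 s)
  · have h1 := Real.rpow_add_le_add_rpow hδ.le (h0 s) he.le he1
    rw [← Real.rpow_mul hε.le, inv_mul_cancel₀ he.ne', Real.rpow_one] at h1
    have h2 : (max 0 (min M s)) ^ e ≤ (ε ^ e⁻¹ + max 0 (min M s)) ^ e :=
      Real.rpow_le_rpow (h0 s) (by linarith) he.le
    rw [abs_of_nonneg (by linarith)]
    linarith

end TravelingWave

noncomputable section

namespace TravelingWave

/-- The weighted reaction term `D^(p'-1) g`. -/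
def reaction (p : ℝ) (D g : ℝ → ℝ) (u : ℝ) : ℝ := D u ^ (conj p - 1) * g u

/-- Standing assumptions on the coefficients. -/
structure Coeffs (p θ : ℝ) (D h g : ℝ → ℝ) : Prop where
  one_lt : 1 < p
  mem_Ioo : θ ∈ Ioo (0 : ℝ) 1
  D_cont : ContinuousOn D (Ioo 0 1)
  D_pos : ∀ u ∈ Ioo (0 : ℝ) 1, 0 < D u
  h_cont : ContinuousOn h (Icc 0 1)
  h_pos : ∀ u ∈ Icc (0 : ℝ) 1, 0 < h u
  g_cont : ContinuousOn g (Icc 0 1)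
  g_zero : ∀ u ∈ Icc 0 θ, g u = 0
  g_pos : ∀ u ∈ Ioo θ 1, 0 < g u
  g_one : g 1 = 0
  integrable : IntervalIntegrable (reaction p D g) MeasureTheory.volume 0 1

/-! ### Integrals and primitives of the coefficients. -/

namespace Coeffs

variable {p θ : ℝ} {D h g : ℝ → ℝ}

theorem conj_gt (hc : Coeffs p θ D h g) : 1 < conj p := one_lt_conj hc.one_lt

theorem reaction_cont (hc : Coeffs p θ D h g) : ContinuousOn (reaction p D g) (Ioo 0 1) :=
  (hc.D_cont.rpow_const fun x hx => Or.inl (hc.D_pos x hx).ne').mul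
    (hc.g_cont.mono Ioo_subset_Icc_self)

theorem reaction_pos (hc : Coeffs p θ D h g) {u : ℝ} (hu : u ∈ Ioo θ 1) :
    0 < reaction p D g u :=
  mul_pos (Real.rpow_pos_of_pos (hc.D_pos u ⟨hc.mem_Ioo.1.trans hu.1, hu.2⟩) _) (hc.g_pos u hu)

theorem reaction_zero (hc : Coeffs p θ D h g) {u : ℝ} (hu : u ∈ Icc 0 θ) :
    reaction p D g u = 0 := by
  rw [reaction, hc.g_zero u hu, mul_zero]

theorem Icc_subset (hc : Coeffs p θ D h g) : Icc θ 1 ⊆ Icc (0 : ℝ) 1 :=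
  Icc_subset_Icc_left hc.mem_Ioo.1.le

theorem integrable_right (hc : Coeffs p θ D h g) :
    IntervalIntegrable (reaction p D g) MeasureTheory.volume θ 1 :=
  hc.integrable.mono_set (by
    rw [uIcc_of_le hc.mem_Ioo.2.le, uIcc_of_le zero_le_one]
    exact hc.Icc_subset)

theorem integrable_left (hc : Coeffs p θ D h g) :
    IntervalIntegrable (reaction p D g) MeasureTheory.volume 0 θ :=
  hc.integrable.mono_set (by
    rw [uIcc_of_le hc.mem_Ioo.1.le, uIcc_of_le zero_le_one]
    exact Icc_subset_Icc_right hc.mem_Ioo.2.le)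

theorem integral_eq (hc : Coeffs p θ D h g) :
    ∫ u in (0 : ℝ)..1, reaction p D g u = ∫ u in θ..1, reaction p D g u := by
  rw [← intervalIntegral.integral_add_adjacent_intervals hc.integrable_left hc.integrable_right]
  have : ∫ u in (0 : ℝ)..θ, reaction p D g u = ∫ _ in (0 : ℝ)..θ, (0 : ℝ) :=
    intervalIntegral.integral_congr fun u hu => by
      rw [uIcc_of_le hc.mem_Ioo.1.le] at hu
      exact hc.reaction_zero hu
  rw [this]
  simp

theorem integral_pos (hc : Coeffs p θ D h g) : 0 < ∫ u in θ..1, reaction p D g u :=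
  intervalIntegral.intervalIntegral_pos_of_pos_on hc.integrable_right
    (fun _ hu => hc.reaction_pos hu) hc.mem_Ioo.2

theorem primitive_cont (hc : Coeffs p θ D h g) :
    ContinuousOn (fun x => ∫ u in θ..x, reaction p D g u) (Icc θ 1) := by
  have := intervalIntegral.continuousOn_primitive_interval' hc.integrable_right left_mem_uIcc
  rwa [uIcc_of_le hc.mem_Ioo.2.le] at this

theorem primitive_deriv (hc : Coeffs p θ D h g) {x : ℝ} (hx : x ∈ Ioo θ 1) :
    HasDerivAt (fun x => ∫ u in θ..x, reaction p D g u) (reaction p D g x) x := by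
  have hx' : x ∈ Ioo (0 : ℝ) 1 := ⟨hc.mem_Ioo.1.trans hx.1, hx.2⟩
  refine intervalIntegral.integral_hasDerivAt_right
    (hc.integrable_right.mono_set ?_)
    (hc.reaction_cont.stronglyMeasurableAtFilter isOpen_Ioo x hx')
    (hc.reaction_cont.continuousAt (isOpen_Ioo.mem_nhds hx'))
  rw [uIcc_of_le hx.1.le, uIcc_of_le hc.mem_Ioo.2.le]
  exact Icc_subset_Icc_right hx.2.le

theorem primitive_nonneg (hc : Coeffs p θ D h g) {x : ℝ} (hx : x ∈ Icc θ 1) :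
    0 ≤ ∫ u in θ..x, reaction p D g u := by
  refine intervalIntegral.integral_nonneg_of_ae_restrict hx.1 ?_
  refine (MeasureTheory.ae_restrict_iff' measurableSet_Icc).2 ?_
  filter_upwards [MeasureTheory.Measure.ae_ne MeasureTheory.volume θ,
    MeasureTheory.Measure.ae_ne MeasureTheory.volume (1 : ℝ)] with u h1 h2 hu
  exact (hc.reaction_pos ⟨lt_of_le_of_ne hu.1 (Ne.symm h1),
    lt_of_le_of_ne (hu.2.trans hx.2) h2⟩).le

theorem h_integrable (hc : Coeffs p θ D h g) {x : ℝ} (hx : x ∈ Icc (0 : ℝ) 1) :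
    IntervalIntegrable h MeasureTheory.volume 0 x :=
  (hc.h_cont.mono (by rw [uIcc_of_le hx.1]; exact Icc_subset_Icc_right hx.2)).intervalIntegrable

theorem convFlux_cont (hc : Coeffs p θ D h g) : ContinuousOn (convFlux h) (Icc 0 1) := by
  have := intervalIntegral.continuousOn_primitive_interval'
    (hc.h_integrable (right_mem_Icc.2 zero_le_one)) left_mem_uIcc
  rwa [uIcc_of_le zero_le_one] at this

theorem convFlux_deriv (hc : Coeffs p θ D h g) {x : ℝ} (hx : x ∈ Ioo (0 : ℝ) 1) :
    HasDerivAt (convFlux h) (h x) x := by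
  have h1 := hc.h_cont.mono Ioo_subset_Icc_self
  exact intervalIntegral.integral_hasDerivAt_right
    (hc.h_integrable (Ioo_subset_Icc_self hx))
    (h1.stronglyMeasurableAtFilter isOpen_Ioo x hx)
    (h1.continuousAt (isOpen_Ioo.mem_nhds hx))

theorem convFlux_zero (h : ℝ → ℝ) : convFlux h 0 = 0 := by simp [convFlux]

theorem convFlux_pos (hc : Coeffs p θ D h g) {x : ℝ} (hx : x ∈ Ioc (0 : ℝ) 1) :
    0 < convFlux h x :=
  intervalIntegral.intervalIntegral_pos_of_pos_on (hc.h_integrable (Ioc_subset_Icc_self hx))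
    (fun u hu => hc.h_pos u ⟨hu.1.le, hu.2.le.trans hx.2⟩) hx.1

end Coeffs

/-! ### The first-order problem on `[θ,1]` -/

/-- `y` is the `p'`-th power of the flux of a front with speed `c`, as a function of the
concentration in `[θ,1]`. -/
structure IsPowerFlux (p θ : ℝ) (D h g : ℝ → ℝ) (c : ℝ) (y : ℝ → ℝ) : Prop where
  cont : ContinuousOn y (Icc θ 1)
  one : y 1 = 0
  pos : ∀ x ∈ Ioo θ 1, 0 < y x
  le : ∀ x ∈ Icc θ 1, y x ≤ conj p * ∫ u in θ..1, reaction p D g u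
  deriv : ∀ x ∈ Ioo θ 1, HasDerivAt y
    (conj p * ((c + h x) * y x ^ ((conj p - 1) / conj p) - reaction p D g x)) x

variable {p θ c : ℝ} {D h g y : ℝ → ℝ}

/-- The reaction term may be unbounded near `1`, so the unknown is `z = y + p' P` with `P` its
primitive; then `z' = p'(c + h) ρ(z - p' P)` has continuous coefficients. The truncation in `ρ` is
inactive a posteriori, because `0 < y ≤ p' P(1)` inside the interval. -/
theorem Coeffs.exists_powerFlux (hc : Coeffs p θ D h g) (hc0 : 0 ≤ c) :
    ∃ y, IsPowerFlux p θ D h g c y := by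
  have hq := hc.conj_gt
  have hq0 : 0 < conj p := by linarith
  have hθ1 := hc.mem_Ioo.2
  set q := conj p with hqdef
  set e := (q - 1) / q with he
  have he0 : 0 < e := div_pos (by linarith) hq0
  have he1 : e ≤ 1 := (div_le_one hq0).2 (by linarith)
  set P : ℝ → ℝ := fun x => ∫ u in θ..x, reaction p D g u with hP
  have hM : 0 ≤ q * P 1 := mul_nonneg hq0.le hc.integral_pos.le
  set ρ : ℝ → ℝ := fun s => (max 0 (min (q * P 1) s)) ^ e with hρ
  have hρ0 : ∀ s, 0 ≤ ρ s := fun s => Real.rpow_nonneg (le_max_left _ _) _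
  have hk : ∀ x ∈ Icc θ 1, 0 ≤ q * (c + h x) := fun x hx =>
    mul_nonneg hq0.le (add_nonneg hc0 (hc.h_pos x (hc.Icc_subset hx)).le)
  obtain ⟨z, hzc, hz1, hzd⟩ := exists_backward_solution (ρ := ρ) (k := fun x => q * (c + h x))
    (A := fun x => q * P x) hθ1.le
    (continuousOn_const.mul (continuousOn_const.add (hc.h_cont.mono hc.Icc_subset))) hk
    (continuousOn_const.mul hc.primitive_cont) (uniformContinuous_rpow_clamp he0.le hM)
    (rpow_clamp_le he0.le hM)
    (fun ε hε => exists_lipschitz_near_rpow_clamp he0 he1 hM hε) (q * P 1)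
  have hyc : ContinuousOn (fun x => z x - q * P x) (Icc θ 1) :=
    hzc.sub (continuousOn_const.mul hc.primitive_cont)
  have hyd : ∀ x ∈ Ioo θ 1, HasDerivAt (fun x => z x - q * P x)
      (q * (c + h x) * ρ (z x - q * P x) - q * reaction p D g x) x := fun x hx =>
    (hzd x hx).sub ((hc.primitive_deriv hx).const_mul q)
  -- `z` is nondecreasing and ends at `p' P(1)`.
  have hle : ∀ x ∈ Icc θ 1, z x - q * P x ≤ q * P 1 := by
    intro x hx
    have h1 := le_add_of_le_deriv_above (w := z) (m := q * P 1) (κ := 0) hx.2 le_rfl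
      (hzc.mono (Icc_subset_Icc_left hx.1)) hz1.le (fun t ht _ => by
        have ht' : t ∈ Ioo θ 1 := ⟨hx.1.trans_lt ht.1, ht.2⟩
        exact ⟨_, hzd t ht', by
          have := mul_nonneg (hk t (Ioo_subset_Icc_self ht')) (hρ0 (z t - q * P t))
          linarith⟩)
    have h2 := mul_nonneg hq0.le (hc.primitive_nonneg hx)
    simp only [hP] at *
    linarith
  have hneg : ∀ x ∈ Ioo θ 1, z x - q * P x ≤ 0 →
      q * (c + h x) * ρ (z x - q * P x) - q * reaction p D g x < 0 := fun x hx hx0 => by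
    have h1 : ρ (z x - q * P x) = 0 := by
      simp only [hρ]
      rw [min_eq_right (hx0.trans hM), max_eq_left hx0, Real.zero_rpow he0.ne']
    rw [h1]
    have := mul_pos hq0 (hc.reaction_pos hx)
    linarith
  -- A nonpositive value of `y` would persist to the right, since `y' < 0` there, and `y` would
  -- decrease strictly to a negative value at `1`.
  have hpos : ∀ x ∈ Ioo θ 1, 0 < z x - q * P x := by
    intro x hx
    by_contra! hx0
    have sub : Icc x 1 ⊆ Icc θ 1 := Icc_subset_Icc_left hx.1.le
    have hnp := image_le_of_deriv_right_lt_deriv_boundary' (hyc.mono sub)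
      (fun t ht => (hyd t ⟨hx.1.trans_le ht.1, ht.2⟩).hasDerivWithinAt) (B := fun _ => 0)
      (B' := fun _ => 0) hx0 continuousOn_const (fun t _ => hasDerivWithinAt_const _ _ _)
      (fun t ht h0 => hneg t ⟨hx.1.trans_le ht.1, ht.2⟩ (by exact h0.le))
    have hanti := strictAntiOn_of_deriv_neg (convex_Icc x 1) (hyc.mono sub) (fun t ht => by
      rw [interior_Icc] at ht
      have ht' : t ∈ Ioo θ 1 := ⟨hx.1.trans ht.1, ht.2⟩
      rw [(hyd t ht').deriv]
      exact hneg t ht' (hnp (Ioo_subset_Icc_self ht)))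
    have := hanti (left_mem_Icc.2 hx.2.le) (right_mem_Icc.2 hx.2.le) hx.2
    simp only [hz1] at this
    linarith
  refine ⟨fun x => z x - q * P x, hyc, by simp [hz1], hpos, hle, fun x hx => ?_⟩
  have h1 : ρ (z x - q * P x) = (z x - q * P x) ^ e := by
    simp only [hρ]
    rw [min_eq_right (hle x (Ioo_subset_Icc_self hx)), max_eq_right (hpos x hx).le]
  have h2 := hyd x hx
  rw [h1] at h2
  convert h2 using 1
  ring

/-- Lipschitz dependence of the power flux at `θ` on the speed. -/
theorem Coeffs.powerFlux_sub_le (hc : Coeffs p θ D h g) {c₁ c₂ : ℝ} {y₁ y₂ : ℝ → ℝ}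
    (hc₁ : 0 ≤ c₁) (h₁ : IsPowerFlux p θ D h g c₁ y₁)
    (h₂ : IsPowerFlux p θ D h g c₂ y₂) :
    y₁ θ - y₂ θ ≤ conj p * (conj p * ∫ u in θ..1, reaction p D g u) ^ ((conj p - 1) / conj p) *
      (1 - θ) * |c₁ - c₂| := by
  have hq0 : 0 < conj p := by linarith [hc.conj_gt]
  have he0 : 0 < (conj p - 1) / conj p := div_pos (by linarith [hc.conj_gt]) hq0
  have hM : 0 ≤ conj p * ∫ u in θ..1, reaction p D g u := mul_nonneg hq0.le hc.integral_pos.le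
  set q := conj p
  set e := (q - 1) / q
  set M := q * ∫ u in θ..1, reaction p D g u
  -- Where `y₁ > y₂`, the term `(c₁ + h)(y₁^e - y₂^e)` has the favourable sign; what remains is `(c₁
  -- - c₂) y₂^e`, of size at most `|c₁ - c₂| M^e`.
  have h3 := le_add_of_le_deriv_above (w := fun x => y₁ x - y₂ x) (m := 0)
    (κ := q * M ^ e * |c₁ - c₂|) hc.mem_Ioo.2.le (by positivity) (h₁.cont.sub h₂.cont)
    (by simp [h₁.one, h₂.one]) (fun x hx hx0 => ⟨_, (h₁.deriv x hx).sub (h₂.deriv x hx), by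
      have hxI := Ioo_subset_Icc_self hx
      have a1 : y₂ x ^ e ≤ y₁ x ^ e :=
        Real.rpow_le_rpow (h₂.pos x hx).le (by linarith) he0.le
      have a2 : y₂ x ^ e ≤ M ^ e := Real.rpow_le_rpow (h₂.pos x hx).le (h₂.le x hxI) he0.le
      have a3 : 0 ≤ y₂ x ^ e := Real.rpow_nonneg (h₂.pos x hx).le _
      have a4 : (c₁ + h x) * y₂ x ^ e ≤ (c₁ + h x) * y₁ x ^ e :=
        mul_le_mul_of_nonneg_left a1 (add_nonneg hc₁ (hc.h_pos x (hc.Icc_subset hxI)).le)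
      have a5 : -(|c₁ - c₂| * M ^ e) ≤ (c₁ - c₂) * y₂ x ^ e := by
        have : |(c₁ - c₂) * y₂ x ^ e| ≤ |c₁ - c₂| * M ^ e := by
          rw [abs_mul, abs_of_nonneg a3]
          exact mul_le_mul_of_nonneg_left a2 (abs_nonneg _)
        exact (abs_le.1 this).1
      have a6 := mul_le_mul_of_nonneg_left
        (show -(|c₁ - c₂| * M ^ e) ≤ (c₁ + h x) * y₁ x ^ e - (c₂ + h x) * y₂ x ^ e by linarith)
        hq0.le
      linarith⟩)
  linarith

/-- The flux `v = y^(1/p')` solves `v' = c + h - D^(p'-1) g v^(1-p')`. -/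
theorem IsPowerFlux.hasDerivAt_rpow (hc : Coeffs p θ D h g) (hy : IsPowerFlux p θ D h g c y)
    {x : ℝ} (hx : x ∈ Ioo θ 1) :
    HasDerivAt (fun x => y x ^ (1 / conj p))
      (c + h x - reaction p D g x * (y x ^ (1 / conj p)) ^ (-(conj p - 1))) x := by
  have hq0 : 0 < conj p := by linarith [hc.conj_gt]
  have hy0 := hy.pos x hx
  convert (hy.deriv x hx).rpow_const (p := 1 / conj p) (Or.inl hy0.ne') using 1
  have e1 : y x ^ (1 / conj p - 1) = (y x ^ ((conj p - 1) / conj p))⁻¹ := by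
    rw [← Real.rpow_neg hy0.le]
    congr 1
    field_simp
    ring
  have e2 : (y x ^ (1 / conj p)) ^ (-(conj p - 1)) = (y x ^ ((conj p - 1) / conj p))⁻¹ := by
    rw [← Real.rpow_mul hy0.le, ← Real.rpow_neg hy0.le]
    congr 1
    field_simp
  have e3 : y x ^ ((conj p - 1) / conj p) ≠ 0 := (Real.rpow_pos_of_pos hy0 _).ne'
  rw [e1, e2]
  field_simp

/-- Standing still is too slow: at speed `0` the flux at `θ` exceeds the convective flux. -/
theorem Coeffs.convFlux_lt_of_speed_zero (hc : Coeffs p θ D h g)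
    (hH : convFlux h 1 ^ conj p ≤ ∫ u in θ..1, reaction p D g u)
    (hy : IsPowerFlux p θ D h g 0 y) : convFlux h θ < y θ ^ (1 / conj p) := by
  have hq := hc.conj_gt
  have hq0 : 0 < conj p := by linarith
  by_contra! hle
  have hH0 : ∀ x ∈ Icc θ 1, 0 < convFlux h x := fun x hx =>
    hc.convFlux_pos ⟨hc.mem_Ioo.1.trans_le hx.1, hx.2⟩
  have hHc := hc.convFlux_cont.mono hc.Icc_subset
  have hyv : ContinuousOn (fun x => y x ^ (1 / conj p)) (Icc θ 1) :=
    hy.cont.rpow_const fun x _ => Or.inr (by positivity)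
  -- At speed `0` the flux grows no faster than `H`, the reaction being nonnegative, so the order
  -- assumed at `θ` persists.
  have h1 : ∀ x ∈ Icc θ 1, y x ^ (1 / conj p) ≤ convFlux h x := by
    intro x hx
    have := le_add_of_deriv_le_above (w := fun x => y x ^ (1 / conj p) - convFlux h x)
      (m := 0) (κ := 0) hx.1 le_rfl ((hyv.sub hHc).mono (Icc_subset_Icc_right hx.2))
      (sub_nonpos.2 hle) (fun t ht _ => by
        have ht' : t ∈ Ioo θ 1 := ⟨ht.1, ht.2.trans_le hx.2⟩
        refine ⟨_, (hy.hasDerivAt_rpow hc ht').sub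
          (hc.convFlux_deriv ⟨hc.mem_Ioo.1.trans ht'.1, ht'.2⟩), ?_⟩
        have h3 := (hc.reaction_pos ht').le
        have h4 : 0 ≤ (y t ^ (1 / conj p)) ^ (-(conj p - 1)) :=
          Real.rpow_nonneg (Real.rpow_nonneg (hy.pos t ht').le _) _
        nlinarith)
    linarith
  -- With `y^((p'-1)/p') ≤ H^(p'-1)`, the function `y - H^p' + p' ∫ D^(p'-1) g` does not increase.
  -- Its values at `θ` and `1` give `p' ∫ D^(p'-1) g ≤ H(1)^p'`, impossible as `p' > 1`.
  have h2 := le_add_of_deriv_le_above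
    (w := fun x => y x - convFlux h x ^ conj p + conj p * ∫ u in θ..x, reaction p D g u)
    (m := y θ - convFlux h θ ^ conj p) (κ := 0) hc.mem_Ioo.2.le le_rfl
    ((hy.cont.sub (hHc.rpow_const fun x _ => Or.inr hq0.le)).add
      (continuousOn_const.mul hc.primitive_cont)) (by simp) (fun x hx _ => by
      have hxI := Ioo_subset_Icc_self hx
      refine ⟨_, ((hy.deriv x hx).sub ((hc.convFlux_deriv ⟨hc.mem_Ioo.1.trans hx.1, hx.2⟩).rpow_const
        (Or.inl (hH0 x hxI).ne'))).add ((hc.primitive_deriv hx).const_mul _), ?_⟩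
      have h3 : y x ^ ((conj p - 1) / conj p) ≤ convFlux h x ^ (conj p - 1) := by
        have h4 := Real.rpow_le_rpow (Real.rpow_nonneg (hy.pos x hx).le _) (h1 x hxI)
          (show 0 ≤ conj p - 1 by linarith)
        rwa [← Real.rpow_mul (hy.pos x hx).le, one_div_mul_eq_div] at h4
      have h5 : conj p * (h x * y x ^ ((conj p - 1) / conj p)) ≤
          conj p * (h x * convFlux h x ^ (conj p - 1)) :=
        mul_le_mul_of_nonneg_left (mul_le_mul_of_nonneg_left h3
          (hc.h_pos x (hc.Icc_subset hxI)).le) hq0.le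
      linarith)
  have hyθ : 0 ≤ y θ := by
    have h6 : ContinuousWithinAt y (Ioi θ) θ :=
      (hy.cont θ (left_mem_Icc.2 hc.mem_Ioo.2.le)).mono_of_mem_nhdsWithin
        (Icc_mem_nhdsGT hc.mem_Ioo.2)
    exact ge_of_tendsto h6 (by
      filter_upwards [Ioo_mem_nhdsGT hc.mem_Ioo.2] with x hx using (hy.pos x hx).le)
  have h7 : y θ ≤ convFlux h θ ^ conj p := by
    have h8 := Real.rpow_le_rpow (Real.rpow_nonneg hyθ _) hle hq0.le
    rwa [← Real.rpow_mul hyθ, one_div_mul_cancel hq0.ne', Real.rpow_one] at h8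
  have h9 := hc.integral_pos
  simp only [hy.one] at h2
  nlinarith

/-- The flux of a front with speed `c` as a function of the concentration in `[0,1]`. -/
structure IsFrontFlux (p : ℝ) (D h g : ℝ → ℝ) (c : ℝ) (V : ℝ → ℝ) : Prop where
  cont : ContinuousOn V (Icc 0 1)
  zero : V 0 = 0
  one : V 1 = 0
  pos : ∀ x ∈ Ioo (0 : ℝ) 1, 0 < V x
  deriv : ∀ x ∈ Ioo (0 : ℝ) 1,
    HasDerivAt V (c + h x - reaction p D g x * V x ^ (-(conj p - 1))) x

/-- The shooting argument: some positive speed matches the fluxes at `θ`. -/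
theorem Coeffs.exists_speed (hc : Coeffs p θ D h g)
    (hH : convFlux h 1 ^ conj p ≤ ∫ u in θ..1, reaction p D g u) :
    ∃ c y, 0 < c ∧ IsPowerFlux p θ D h g c y ∧
      y θ ^ (1 / conj p) = c * θ + convFlux h θ := by
  have hq := hc.conj_gt
  have hq0 : 0 < conj p := by linarith
  have hθ0 := hc.mem_Ioo.1
  have hθI : θ ∈ Icc θ 1 := left_mem_Icc.2 hc.mem_Ioo.2.le
  choose! Y hY using fun (c : ℝ) (hc0 : 0 ≤ c) => hc.exists_powerFlux hc0
  set M := conj p * ∫ u in θ..1, reaction p D g u with hM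
  have hM0 : 0 ≤ M := mul_nonneg hq0.le hc.integral_pos.le
  -- Chosen so that `C θ` alone already matches the a priori bound for `y(θ)^(1/p')`.
  set C := M ^ (1 / conj p) / θ with hC
  have hC0 : 0 ≤ C := div_nonneg (Real.rpow_nonneg hM0 _) hθ0.le
  have hlip : LipschitzOnWith (conj p * M ^ ((conj p - 1) / conj p) * (1 - θ)).toNNReal
      (fun c => Y c θ) (Icc 0 C) := by
    refine LipschitzOnWith.of_dist_le_mul fun c hc1 c' hc2 => ?_
    have h0 : 0 ≤ 1 - θ := by linarith [hc.mem_Ioo.2]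
    rw [Real.coe_toNNReal _ (by positivity), Real.dist_eq, Real.dist_eq, abs_le]
    have h1 := hc.powerFlux_sub_le hc1.1 (hY c hc1.1) (hY c' hc2.1)
    have h2 := hc.powerFlux_sub_le hc2.1 (hY c' hc2.1) (hY c hc1.1)
    rw [abs_sub_comm c' c] at h2
    constructor <;> linarith
  have hcont : ContinuousOn (fun c => Y c θ ^ (1 / conj p) - (c * θ + convFlux h θ)) (Icc 0 C) :=
    (hlip.continuousOn.rpow_const fun _ _ => Or.inr (by positivity)).sub
      ((continuousOn_id.mul continuousOn_const).add continuousOn_const)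
  have hY0 : ∀ c, 0 ≤ c → 0 ≤ Y c θ := fun c hc0 => by
    have h6 : ContinuousWithinAt (Y c) (Ioi θ) θ :=
      ((hY c hc0).cont θ hθI).mono_of_mem_nhdsWithin (Icc_mem_nhdsGT hc.mem_Ioo.2)
    exact ge_of_tendsto h6 (by
      filter_upwards [Ioo_mem_nhdsGT hc.mem_Ioo.2] with x hx using ((hY c hc0).pos x hx).le)
  have h0 := hc.convFlux_lt_of_speed_zero hH (hY 0 le_rfl)
  have hCle : Y C θ ^ (1 / conj p) - (C * θ + convFlux h θ) ≤ 0 := by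
    have h1 : Y C θ ^ (1 / conj p) ≤ M ^ (1 / conj p) :=
      Real.rpow_le_rpow (hY0 C hC0) ((hY C hC0).le θ hθI) (by positivity)
    have h2 : C * θ = M ^ (1 / conj p) := div_mul_cancel₀ _ hθ0.ne'
    have h3 := hc.convFlux_pos (x := θ) ⟨hθ0, hc.mem_Ioo.2.le⟩
    linarith
  obtain ⟨c, hcI, hceq⟩ := intermediate_value_Icc' hC0 hcont
    (show (0 : ℝ) ∈ _ from ⟨hCle, by simpa using h0.le⟩)
  simp only at hceq
  refine ⟨c, Y c, lt_of_le_of_ne hcI.1 ?_, hY c hcI.1, by linarith⟩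
  rintro rfl
  linarith

/-- The two branches agree at `θ` by the choice of `c`. They join differentiably because the
reaction vanishes at `θ` while `V(θ) > 0`. -/
theorem Coeffs.exists_frontFlux (hc : Coeffs p θ D h g)
    (hH : convFlux h 1 ^ conj p ≤ ∫ u in θ..1, reaction p D g u) :
    ∃ c V, 0 < c ∧ IsFrontFlux p D h g c V ∧ ∀ s ≤ θ, V s = c * s + convFlux h s := by
  obtain ⟨c, y, hc0, hy, hyθ⟩ := hc.exists_speed hH
  have hq0 : 0 < conj p := by linarith [hc.conj_gt]
  obtain ⟨hθ0, hθ1⟩ := hc.mem_Ioo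
  set V : ℝ → ℝ := fun s => if s ≤ θ then c * s + convFlux h s else y s ^ (1 / conj p) with hV
  have hVl : ∀ s, s ≤ θ → V s = c * s + convFlux h s := fun s hs => if_pos hs
  have hVr : ∀ s, θ ≤ s → V s = y s ^ (1 / conj p) := fun s hs => by
    rcases hs.eq_or_lt with rfl | h1
    · rw [hVl _ le_rfl, hyθ]
    · exact if_neg h1.not_ge
  have hpos : ∀ x ∈ Ioo (0 : ℝ) 1, 0 < V x := fun x hx => by
    rcases le_or_gt x θ with h1 | h1
    · rw [hVl x h1]
      have := hc.convFlux_pos (Ioo_subset_Ioc_self hx)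
      have := mul_pos hc0 hx.1
      linarith
    · rw [hVr x h1.le]
      exact Real.rpow_pos_of_pos (hy.pos x ⟨h1, hx.2⟩) _
  have hcontl : ContinuousOn V (Icc 0 θ) :=
    ((continuousOn_const.mul continuousOn_id).add
      (hc.convFlux_cont.mono (Icc_subset_Icc_right hθ1.le))).congr fun s hs => hVl s hs.2
  have hcontr : ContinuousOn V (Icc θ 1) :=
    (hy.cont.rpow_const fun x _ => Or.inr (by positivity)).congr fun s hs => hVr s hs.1
  have hcont : ContinuousOn V (Icc 0 1) := by
    rw [← Icc_union_Icc_eq_Icc hθ0.le hθ1.le]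
    exact hcontl.union_of_isClosed hcontr isClosed_Icc isClosed_Icc
  have hdl : ∀ x ∈ Ioo (0 : ℝ) 1, HasDerivAt (fun s => c * s + convFlux h s) (c + h x) x :=
    fun x hx => by
      have h1 := ((hasDerivAt_id x).const_mul c).add (hc.convFlux_deriv hx)
      rw [mul_one] at h1
      exact h1
  have hdr : ∀ x ∈ Ioo θ 1,
      HasDerivAt V (c + h x - reaction p D g x * V x ^ (-(conj p - 1))) x := fun x hx => by
    rw [hVr x hx.1.le]
    exact (hy.hasDerivAt_rpow hc hx).congr_of_eventuallyEq (by
      filter_upwards [Ioi_mem_nhds hx.1] with s hs using hVr s (le_of_lt hs))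
  refine ⟨c, V, hc0, ⟨hcont, ?_, ?_, hpos, fun x hx => ?_⟩, hVl⟩
  · rw [hVl 0 hθ0.le, Coeffs.convFlux_zero]
    simp
  · rw [hVr 1 hθ1.le, hy.one, Real.zero_rpow (by positivity)]
  · rcases lt_trichotomy x θ with h1 | rfl | h1
    · rw [hc.reaction_zero ⟨hx.1.le, h1.le⟩, zero_mul, sub_zero]
      exact (hdl x hx).congr_of_eventuallyEq (by
        filter_upwards [Iio_mem_nhds h1] with s hs using hVl s (le_of_lt hs))
    · have hVx := hcont.continuousAt (Icc_mem_nhds hx.1 hx.2)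
      have hl : HasDerivWithinAt V (c + h x - reaction p D g x * V x ^ (-(conj p - 1)))
          (Iic x) x := by
        rw [hc.reaction_zero ⟨hx.1.le, le_rfl⟩, zero_mul, sub_zero]
        exact (hdl x hx).hasDerivWithinAt.congr (fun s hs => hVl s hs) (hVl x le_rfl)
      have hr : HasDerivWithinAt V (c + h x - reaction p D g x * V x ^ (-(conj p - 1)))
          (Ici x) x := by
        -- The equation for `y` is only known to the right of `θ`; the one-sided derivative at `θ`
        -- is the limit of the derivatives there.
        refine hasDerivWithinAt_Ici_of_tendsto_deriv (s := Ioo x 1)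
          (fun s hs => (hdr s hs).differentiableAt.differentiableWithinAt)
          hVx.continuousWithinAt (Ioo_mem_nhdsGT hx.2) ?_
        have hlim : ContinuousAt
            (fun s => c + h s - reaction p D g s * V s ^ (-(conj p - 1))) x :=
          (continuousAt_const.add (hc.h_cont.continuousAt (Icc_mem_nhds hx.1 hx.2))).sub
            ((hc.reaction_cont.continuousAt (isOpen_Ioo.mem_nhds hx)).mul
              (hVx.rpow_const (Or.inl (hpos x hx).ne')))
        refine (hlim.tendsto.mono_left nhdsWithin_le_nhds).congr' ?_
        filter_upwards [Ioo_mem_nhdsGT hx.2] with s hs using (hdr s hs).deriv.symm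
      have := hl.union hr
      rwa [Iic_union_Ici, hasDerivWithinAt_univ] at this
    · exact hdr x ⟨h1, hx.2⟩

/-! ### Inverting the arrival time -/

/-- The profile that passes the level `s` at the time `T s`, extended by the equilibria. -/
def profileOf (T : ℝ → ℝ) (ξ : ℝ) : ℝ := sSup (insert 0 {s | s ∈ Ioo (0 : ℝ) 1 ∧ ξ < T s})

section ProfileOf

variable {T : ℝ → ℝ} {s ξ : ℝ}

theorem profileOf_bddAbove (T : ℝ → ℝ) (ξ : ℝ) :
    BddAbove (insert 0 {s | s ∈ Ioo (0 : ℝ) 1 ∧ ξ < T s}) :=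
  ⟨1, by rintro s (rfl | hs); exacts [zero_le_one, hs.1.2.le]⟩

theorem profileOf_mem_Icc (T : ℝ → ℝ) (ξ : ℝ) : profileOf T ξ ∈ Icc (0 : ℝ) 1 :=
  ⟨le_csSup (profileOf_bddAbove T ξ) (mem_insert _ _),
    csSup_le (insert_nonempty _ _) (by rintro s (rfl | hs); exacts [zero_le_one, hs.1.2.le])⟩

theorem le_profileOf (hs : s ∈ Ioo (0 : ℝ) 1) (h : ξ < T s) : s ≤ profileOf T ξ :=
  le_csSup (profileOf_bddAbove T ξ) (mem_insert_of_mem _ ⟨hs, h⟩)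

theorem profileOf_le (hT : StrictAntiOn T (Ioo 0 1)) (hs : s ∈ Ioo (0 : ℝ) 1) (h : T s ≤ ξ) :
    profileOf T ξ ≤ s := by
  refine csSup_le (insert_nonempty _ _) ?_
  rintro t (rfl | ht)
  · exact hs.1.le
  · exact ((hT.lt_iff_gt hs ht.1).1 (h.trans_lt ht.2)).le

theorem profileOf_apply (hT : StrictAntiOn T (Ioo 0 1)) (hs : s ∈ Ioo (0 : ℝ) 1) :
    profileOf T (T s) = s := by
  refine le_antisymm (profileOf_le hT hs le_rfl) ?_
  by_contra! hlt
  obtain ⟨t, ht1, ht2⟩ := exists_between hlt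
  have ht : t ∈ Ioo (0 : ℝ) 1 := ⟨(profileOf_mem_Icc T _).1.trans_lt ht1, ht2.trans hs.2⟩
  exact ht1.not_ge (le_profileOf ht (hT ht hs ht2))

theorem profileOf_eq_zero (h : ∀ s ∈ Ioo (0 : ℝ) 1, T s ≤ ξ) : profileOf T ξ = 0 := by
  refine le_antisymm (csSup_le (insert_nonempty _ _) ?_) (profileOf_mem_Icc T ξ).1
  rintro t (rfl | ht)
  · exact le_rfl
  · exact absurd ht.2 (h t ht.1).not_gt

theorem profileOf_eq_one (h : ∀ s ∈ Ioo (0 : ℝ) 1, ξ < T s) : profileOf T ξ = 1 := by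
  refine le_antisymm (profileOf_mem_Icc T ξ).2 ?_
  by_contra! hlt
  obtain ⟨t, ht1, ht2⟩ := exists_between hlt
  have ht : t ∈ Ioo (0 : ℝ) 1 := ⟨(profileOf_mem_Icc T _).1.trans_lt ht1, ht2⟩
  exact ht1.not_ge (le_profileOf ht (h t ht))

theorem apply_profileOf (hT : StrictAntiOn T (Ioo 0 1)) (hTc : ContinuousOn T (Ioo 0 1))
    (h : profileOf T ξ ∈ Ioo (0 : ℝ) 1) : T (profileOf T ξ) = ξ := by
  have hc := hTc.continuousAt (isOpen_Ioo.mem_nhds h)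
  have hI : ∀ᶠ s in 𝓝 (profileOf T ξ), s ∈ Ioo (0 : ℝ) 1 := isOpen_Ioo.mem_nhds h
  rcases lt_trichotomy (T (profileOf T ξ)) ξ with h1 | h1 | h1
  · obtain ⟨s, ⟨hs1, hs2⟩, hs3⟩ := (((hI.and (hc.eventually (gt_mem_nhds h1))).filter_mono
      nhdsWithin_le_nhds).and (self_mem_nhdsWithin (s := Iio (profileOf T ξ)))).exists
    exact absurd (profileOf_le hT hs1 (le_of_lt hs2)) (not_le.2 hs3)
  · exact h1
  · obtain ⟨s, ⟨hs1, hs2⟩, hs3⟩ := (((hI.and (hc.eventually (lt_mem_nhds h1))).filter_mono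
      nhdsWithin_le_nhds).and (self_mem_nhdsWithin (s := Ioi (profileOf T ξ)))).exists
    exact absurd (le_profileOf hs1 hs2) (not_le.2 hs3)

theorem profileOf_antitone (T : ℝ → ℝ) : Antitone (profileOf T) := fun ξ _ h =>
  csSup_le_csSup (profileOf_bddAbove T ξ) (insert_nonempty _ _)
    (insert_subset_insert fun _ hs => ⟨hs.1, h.trans_lt hs.2⟩)

/-- A monotone map with dense range has no jumps, and every level in `(0,1)` is attained. The order
dual turns antitone into monotone. -/
theorem profileOf_continuous (hT : StrictAntiOn T (Ioo 0 1)) : Continuous (profileOf T) := by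
  let u : ℝ → (Icc (0 : ℝ) 1)ᵒᵈ := fun ξ => OrderDual.toDual ⟨profileOf T ξ, profileOf_mem_Icc T ξ⟩
  have hu : Monotone u := fun ξ η h => profileOf_antitone T h
  have hd : DenseRange u := by
    have h1 : Dense {x : Icc (0 : ℝ) 1 | (x : ℝ) ∈ Ioo (0 : ℝ) 1} := by
      rw [Subtype.dense_iff]
      intro x hx
      have : (Subtype.val '' {x : Icc (0 : ℝ) 1 | (x : ℝ) ∈ Ioo (0 : ℝ) 1}) = Ioo 0 1 := by
        ext y
        constructor
        · rintro ⟨z, hz, rfl⟩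
          exact hz
        · exact fun hy => ⟨⟨y, Ioo_subset_Icc_self hy⟩, hy, rfl⟩
      rw [this, closure_Ioo zero_ne_one]
      exact hx
    have h2 : Dense (OrderDual.ofDual ⁻¹' {x : Icc (0 : ℝ) 1 | (x : ℝ) ∈ Ioo (0 : ℝ) 1}) := h1
    refine h2.mono fun x hx => ⟨T (OrderDual.ofDual x : Icc (0 : ℝ) 1), ?_⟩
    exact congrArg OrderDual.toDual (Subtype.ext (profileOf_apply hT hx))
  have hc := hu.continuous_of_denseRange hd
  exact continuous_subtype_val.comp (continuous_ofDual.comp hc)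

theorem profileOf_tendsto_atBot (T : ℝ → ℝ) : Tendsto (profileOf T) atBot (𝓝 1) := by
  refine tendsto_order.2 ⟨fun a ha => ?_, fun a ha => .of_forall fun ξ =>
    (profileOf_mem_Icc T ξ).2.trans_lt ha⟩
  obtain ⟨s, hs1, hs2⟩ := exists_between (max_lt ha zero_lt_one)
  filter_upwards [Iio_mem_atBot (T s)] with ξ hξ
  exact ((le_max_left _ _).trans_lt hs1).trans_le
    (le_profileOf ⟨(le_max_right _ _).trans_lt hs1, hs2⟩ hξ)

theorem profileOf_tendsto_atTop (hT : StrictAntiOn T (Ioo 0 1)) :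
    Tendsto (profileOf T) atTop (𝓝 0) := by
  refine tendsto_order.2 ⟨fun a ha => .of_forall fun ξ => ha.trans_le (profileOf_mem_Icc T ξ).1,
    fun a ha => ?_⟩
  obtain ⟨s, hs1, hs2⟩ := exists_between (lt_min ha zero_lt_one)
  filter_upwards [Ici_mem_atTop (T s)] with ξ hξ
  exact (profileOf_le hT ⟨hs1, hs2.trans_le (min_le_right _ _)⟩ hξ).trans_lt
    (hs2.trans_le (min_le_left _ _))

end ProfileOf

/-! ### The profile with a given flux -/

/-- The speed at which the profile with flux `V` decreases. -/
def decayRate (p : ℝ) (D V : ℝ → ℝ) (s : ℝ) : ℝ := (V s / D s) ^ (conj p - 1)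

/-- The time at which the profile with flux `V` reaches the level `s`. -/
def arrivalTime (p : ℝ) (D V : ℝ → ℝ) (s : ℝ) : ℝ := ∫ t in s..(1 / 2), (decayRate p D V t)⁻¹

variable {p θ c : ℝ} {D h g V : ℝ → ℝ}

theorem decayRate_pos (hc : Coeffs p θ D h g) (hV : IsFrontFlux p D h g c V) {s : ℝ}
    (hs : s ∈ Ioo (0 : ℝ) 1) : 0 < decayRate p D V s :=
  Real.rpow_pos_of_pos (div_pos (hV.pos s hs) (hc.D_pos s hs)) _

theorem decayRate_cont (hc : Coeffs p θ D h g) (hV : IsFrontFlux p D h g c V) :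
    ContinuousOn (decayRate p D V) (Ioo 0 1) :=
  ((hV.cont.mono Ioo_subset_Icc_self).div hc.D_cont fun s hs => (hc.D_pos s hs).ne').rpow_const
    fun s hs => Or.inl (div_pos (hV.pos s hs) (hc.D_pos s hs)).ne'

theorem arrivalTime_deriv (hc : Coeffs p θ D h g) (hV : IsFrontFlux p D h g c V) {s : ℝ}
    (hs : s ∈ Ioo (0 : ℝ) 1) :
    HasDerivAt (arrivalTime p D V) (-(decayRate p D V s)⁻¹) s := by
  have hcont : ContinuousOn (fun t => (decayRate p D V t)⁻¹) (Ioo 0 1) :=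
    (decayRate_cont hc hV).inv₀ fun t ht => (decayRate_pos hc hV ht).ne'
  refine intervalIntegral.integral_hasDerivAt_left (ContinuousOn.intervalIntegrable
    (hcont.mono ?_)) (hcont.stronglyMeasurableAtFilter isOpen_Ioo s hs)
    (hcont.continuousAt (isOpen_Ioo.mem_nhds hs))
  exact (convex_Ioo (0 : ℝ) 1).ordConnected.uIcc_subset hs (by norm_num)

theorem arrivalTime_cont (hc : Coeffs p θ D h g) (hV : IsFrontFlux p D h g c V) :
    ContinuousOn (arrivalTime p D V) (Ioo 0 1) := fun _ hs =>
  (arrivalTime_deriv hc hV hs).continuousAt.continuousWithinAt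

theorem arrivalTime_strictAnti (hc : Coeffs p θ D h g) (hV : IsFrontFlux p D h g c V) :
    StrictAntiOn (arrivalTime p D V) (Ioo 0 1) :=
  strictAntiOn_of_deriv_neg (convex_Ioo _ _) (arrivalTime_cont hc hV) fun s hs => by
    rw [interior_Ioo] at hs
    rw [(arrivalTime_deriv hc hV hs).deriv]
    exact neg_lt_zero.2 (inv_pos.2 (decayRate_pos hc hV hs))

/-- The flux of a decreasing function in terms of its slope. -/
theorem flux_of_rate (hp : 1 < p) {d v : ℝ} (hd : 0 < d) (hv : 0 < v) :
    d * |-(v / d) ^ (conj p - 1)| ^ (p - 2) * -(v / d) ^ (conj p - 1) = -v := by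
  have hx : 0 < v / d := div_pos hv hd
  have hr : 0 < (v / d) ^ (conj p - 1) := Real.rpow_pos_of_pos hx _
  rw [abs_neg, abs_of_pos hr]
  have h1 : ((v / d) ^ (conj p - 1)) ^ (p - 2) * (v / d) ^ (conj p - 1) = v / d := by
    rw [← Real.rpow_add_one hr.ne', ← Real.rpow_mul hx.le]
    have : (conj p - 1) * (p - 2 + 1) = 1 := by
      rw [show p - 2 + 1 = p - 1 by ring, conj_sub_one_mul hp]
    rw [this, Real.rpow_one]
  rw [mul_neg, mul_assoc, h1]
  field_simp

/-- The slope of a decreasing function in terms of its flux. -/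
theorem rate_of_flux (hp : 1 < p) {d u' : ℝ} (hd : 0 < d) (hu : u' < 0) :
    (-(d * |u'| ^ (p - 2) * u') / d) ^ (conj p - 1) = -u' := by
  have h0 : 0 < -u' := neg_pos.2 hu
  have h1 : -(d * |u'| ^ (p - 2) * u') / d = (-u') ^ (p - 1) := by
    rw [abs_of_neg hu, show p - 1 = p - 2 + 1 by ring, Real.rpow_add_one h0.ne']
    field_simp
  rw [h1, ← Real.rpow_mul h0.le, mul_comm, conj_sub_one_mul hp, Real.rpow_one]

/-- The reaction term seen along a profile whose flux at the level `s` is `-v`. -/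
theorem reaction_mul_rpow (hc : Coeffs p θ D h g) {s v : ℝ} (hs : s ∈ Ioo (0 : ℝ) 1)
    (hv : 0 < v) (w : ℝ) :
    reaction p D g s * w * (v / D s) ^ (conj p - 1) = g s * (w * v ^ (conj p - 1)) := by
  have hD := hc.D_pos s hs
  rw [Real.div_rpow hv.le hD.le, reaction]
  have : D s ^ (conj p - 1) ≠ 0 := (Real.rpow_pos_of_pos hD _).ne'
  field_simp

theorem isOpen_interiorSet {u : ℝ → ℝ} (hu : Continuous u) : IsOpen (interiorSet u) :=
  isOpen_Ioo.preimage hu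

/-- Every front flux is the flux of a profile. -/
theorem isProfile_profileOf (hc : Coeffs p θ D h g) (hV : IsFrontFlux p D h g c V) :
    IsProfile p D h g c (profileOf (arrivalTime p D V)) := by
  have hT := arrivalTime_strictAnti hc hV
  have hTc := arrivalTime_cont hc hV
  set u := profileOf (arrivalTime p D V) with hu
  have huI : ∀ ξ, u ξ ∈ Icc (0 : ℝ) 1 := profileOf_mem_Icc _
  have huc : Continuous u := profileOf_continuous hT
  have hopen := isOpen_interiorSet huc
  have hud : ∀ ξ ∈ interiorSet u, HasDerivAt u (-decayRate p D V (u ξ)) ξ := fun ξ hξ => by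
    have h1 := HasDerivAt.of_local_left_inverse huc.continuousAt (arrivalTime_deriv hc hV hξ)
      (neg_ne_zero.2 (inv_pos.2 (decayRate_pos hc hV hξ)).ne')
      (by filter_upwards [hopen.mem_nhds hξ] with η hη using apply_profileOf hT hTc hη)
    rwa [inv_neg, inv_inv] at h1
  have hflux : diffFlux p D u = fun ξ => -V (u ξ) := by
    ext ξ
    by_cases hξ : ξ ∈ interiorSet u
    · rw [diffFlux, indicator_of_mem hξ, (hud ξ hξ).deriv]
      exact flux_of_rate hc.one_lt (hc.D_pos _ hξ) (hV.pos _ hξ)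
    · rw [diffFlux, indicator_of_notMem hξ]
      rcases (huI ξ).1.eq_or_lt with h1 | h1
      · rw [← h1, hV.zero, neg_zero]
      · have : u ξ = 1 := le_antisymm (huI ξ).2 (not_lt.1 fun h2 => hξ ⟨h1, h2⟩)
        rw [this, hV.one, neg_zero]
  have hVu : Continuous fun ξ => -V (u ξ) := (hV.cont.comp_continuous huc huI).neg
  have hlim : ∀ a ∈ Icc (0 : ℝ) 1, V a = 0 →
      Tendsto (diffFlux p D u) (comap u (𝓝 a)) (𝓝 0) := fun a ha ha0 => by
    rw [hflux, ← neg_zero, ← ha0]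
    refine Tendsto.neg ((hV.cont a ha).tendsto.comp ?_)
    exact tendsto_nhdsWithin_iff.2 ⟨tendsto_comap, .of_forall huI⟩
  refine ⟨huI, huc, ?_, fun ξ hξ => ?_, hflux ▸ hVu, hlim 0 (by simp) hV.zero,
    hlim 1 (by simp) hV.one, profileOf_tendsto_atBot _, profileOf_tendsto_atTop hT⟩
  · have h1 : ContDiffOn ℝ (0 + 1) u (interiorSet u) := by
      rw [contDiffOn_succ_iff_deriv_of_isOpen hopen]
      refine ⟨fun ξ hξ => (hud ξ hξ).differentiableAt.differentiableWithinAt, by simp, ?_⟩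
      rw [contDiffOn_zero]
      refine ContinuousOn.congr ?_ (fun ξ hξ => (hud ξ hξ).deriv)
      exact ((decayRate_cont hc hV).comp huc.continuousOn fun ξ hξ => hξ).neg
    simpa using h1
  · have h1 := ((hV.deriv (u ξ) hξ).comp ξ (hud ξ hξ)).neg
    rw [show -(V ∘ u) = diffFlux p D u from hflux.symm] at h1
    refine ⟨h1.differentiableAt, ?_⟩
    -- Multiplied by the decay rate `(V/D)^(p'-1)`, the term `D^(p'-1) g V^(1-p')` collapses to `g`.
    have h2 := reaction_mul_rpow hc hξ (hV.pos _ hξ) (V (u ξ) ^ (-(conj p - 1)))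
    rw [← Real.rpow_add (hV.pos _ hξ), neg_add_cancel, Real.rpow_zero, mul_one] at h2
    rw [h1.deriv, (hud ξ hξ).deriv]
    rw [← decayRate] at h2
    linarith

theorem eventually_lt_left_of_deriv_neg {f : ℝ → ℝ} {f' x : ℝ} (hf : HasDerivAt f f' x)
    (hf' : f' < 0) : ∀ᶠ y in 𝓝[<] x, f x < f y := by
  have h1 := (hasDerivAt_iff_tendsto_slope.1 hf).mono_left (nhdsLT_le_nhdsNE x)
  filter_upwards [h1.eventually (gt_mem_nhds hf'), self_mem_nhdsWithin] with y hy hyx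
  rw [slope_def_field, div_neg_iff] at hy
  have : y - x < 0 := sub_neg.2 hyx
  rcases hy with hy | hy <;> linarith

theorem eventually_lt_right_of_deriv_neg {f : ℝ → ℝ} {f' x : ℝ} (hf : HasDerivAt f f' x)
    (hf' : f' < 0) : ∀ᶠ y in 𝓝[>] x, f y < f x := by
  have h1 := (hasDerivAt_iff_tendsto_slope.1 hf).mono_left (nhdsGT_le_nhdsNE x)
  filter_upwards [h1.eventually (gt_mem_nhds hf'), self_mem_nhdsWithin] with y hy hyx
  rw [slope_def_field, div_neg_iff] at hy
  have : 0 < y - x := sub_pos.2 hyx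
  rcases hy with hy | hy <;> linarith

/-- A function that starts from `0` at `-∞` and does not increase where it is positive is
nonpositive. -/
theorem nonpos_of_tendsto_atBot {w : ℝ → ℝ} {α : ℝ} (hw : ContinuousOn w (Iic α))
    (h0 : Tendsto w atBot (𝓝 0))
    (hd : ∀ x < α, 0 < w x → ∃ w', HasDerivAt w w' x ∧ w' ≤ 0) {x : ℝ} (hx : x ≤ α) :
    w x ≤ 0 := by
  refine le_of_forall_pos_le_add fun ε hε => ?_
  obtain ⟨N, hN, hNx⟩ := ((h0.eventually (gt_mem_nhds hε)).and (eventually_le_atBot x)).exists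
  have := le_add_of_deriv_le_above (m := ε) (κ := 0) hNx le_rfl
    (hw.mono fun t ht => ht.2.trans hx) hN.le
    (fun t ht h => hd t (ht.2.trans_le hx) (hε.trans h))
  linarith

/-! ### Structure of an arbitrary profile -/

variable {p θ b c : ℝ} {D h g V u : ℝ → ℝ}

/-- The total flux: diffusive flux plus convective flux in the moving frame. -/
def totalFlux (p : ℝ) (D h : ℝ → ℝ) (b : ℝ) (u : ℝ → ℝ) (ξ : ℝ) : ℝ :=
  diffFlux p D u ξ + (b * u ξ + convFlux h (u ξ))

theorem diffFlux_of_mem {ξ : ℝ} (hξ : ξ ∈ interiorSet u) :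
    diffFlux p D u ξ = D (u ξ) * |deriv u ξ| ^ (p - 2) * deriv u ξ :=
  indicator_of_mem hξ _

/-- Where `u' = 0` is possible, only `|u'|^(p-2) ≥ 0` is used, so the value of `0^(p-2)` is
irrelevant. -/
theorem diffFlux_neg_iff (hc : Coeffs p θ D h g) {ξ : ℝ} (hξ : ξ ∈ interiorSet u) :
    diffFlux p D u ξ < 0 ↔ deriv u ξ < 0 := by
  have h0 : 0 ≤ D (u ξ) * |deriv u ξ| ^ (p - 2) :=
    mul_nonneg (hc.D_pos _ hξ).le (Real.rpow_nonneg (abs_nonneg _) _)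
  rw [diffFlux_of_mem hξ]
  constructor
  · intro h1
    by_contra! h2
    exact h1.not_ge (mul_nonneg h0 h2)
  · intro h1
    exact mul_neg_of_pos_of_neg
      (mul_pos (hc.D_pos _ hξ) (Real.rpow_pos_of_pos (abs_pos.2 h1.ne) _)) h1

theorem diffFlux_pos_iff (hc : Coeffs p θ D h g) {ξ : ℝ} (hξ : ξ ∈ interiorSet u) :
    0 < diffFlux p D u ξ ↔ 0 < deriv u ξ := by
  have h0 : 0 ≤ D (u ξ) * |deriv u ξ| ^ (p - 2) :=
    mul_nonneg (hc.D_pos _ hξ).le (Real.rpow_nonneg (abs_nonneg _) _)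
  rw [diffFlux_of_mem hξ]
  constructor
  · intro h1
    by_contra! h2
    exact h1.not_ge (mul_nonpos_of_nonneg_of_nonpos h0 h2)
  · intro h1
    exact mul_pos (mul_pos (hc.D_pos _ hξ) (Real.rpow_pos_of_pos (abs_pos.2 h1.ne') _)) h1

namespace IsProfile

theorem mem_interior_or (hu : IsProfile p D h g b u) (ξ : ℝ) :
    ξ ∈ interiorSet u ∨ (u ξ = 0 ∨ u ξ = 1) ∧ diffFlux p D u ξ = 0 := by
  by_cases hξ : ξ ∈ interiorSet u
  · exact Or.inl hξ
  · refine Or.inr ⟨?_, indicator_of_notMem hξ _⟩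
    rcases (hu.mem_Icc ξ).1.eq_or_lt with h1 | h1
    · exact Or.inl h1.symm
    · exact Or.inr (le_antisymm (hu.mem_Icc ξ).2 (not_lt.1 fun h2 => hξ ⟨h1, h2⟩))

theorem hasDerivAt (hu : IsProfile p D h g b u) {ξ : ℝ} (hξ : ξ ∈ interiorSet u) :
    HasDerivAt u (deriv u ξ) ξ :=
  ((hu.contDiffOn.differentiableOn one_ne_zero).differentiableAt
    ((isOpen_interiorSet hu.continuous).mem_nhds hξ)).hasDerivAt

theorem diffFlux_hasDerivAt (hu : IsProfile p D h g b u) {ξ : ℝ} (hξ : ξ ∈ interiorSet u) :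
    HasDerivAt (diffFlux p D u) (-(b + h (u ξ)) * deriv u ξ - g (u ξ)) ξ := by
  obtain ⟨h1, h2⟩ := hu.equation ξ hξ
  exact h1.hasDerivAt.congr_deriv (by linarith)

theorem totalFlux_hasDerivAt (hc : Coeffs p θ D h g) (hu : IsProfile p D h g b u) {ξ : ℝ}
    (hξ : ξ ∈ interiorSet u) : HasDerivAt (totalFlux p D h b u) (-g (u ξ)) ξ := by
  have h1 := (hu.diffFlux_hasDerivAt hξ).add (((hu.hasDerivAt hξ).const_mul b).add
    ((hc.convFlux_deriv hξ).comp ξ (hu.hasDerivAt hξ)))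
  exact h1.congr_deriv (by ring)

theorem totalFlux_cont (hc : Coeffs p θ D h g) (hu : IsProfile p D h g b u) :
    Continuous (totalFlux p D h b u) :=
  hu.flux_continuous.add ((continuous_const.mul hu.continuous).add
    (hc.convFlux_cont.comp_continuous hu.continuous hu.mem_Icc))

/-- At the equilibria `u` need not be differentiable, but the total flux takes only two values
there; `le_of_deriv_nonpos_of_finite_values` tolerates this. -/
theorem totalFlux_mem_interior_or (hu : IsProfile p D h g b u) (ξ : ℝ) :
    ξ ∈ interiorSet u ∨
      totalFlux p D h b u ξ ∈ ({0, b + convFlux h 1} : Set ℝ) := by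
  rcases hu.mem_interior_or ξ with h1 | ⟨h1 | h1, h2⟩
  · exact Or.inl h1
  · right
    left
    rw [totalFlux, h2, h1, Coeffs.convFlux_zero]
    simp
  · right
    right
    rw [mem_singleton_iff, totalFlux, h2, h1]
    ring

theorem g_nonneg (hc : Coeffs p θ D h g) {s : ℝ} (hs : s ∈ Icc (0 : ℝ) 1) : 0 ≤ g s := by
  rcases le_or_gt s θ with h1 | h1
  · exact (hc.g_zero s ⟨hs.1, h1⟩).ge
  · rcases hs.2.eq_or_lt with h2 | h2
    · rw [h2, hc.g_one]
    · exact (hc.g_pos s ⟨h1, h2⟩).le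

theorem totalFlux_antitone (hc : Coeffs p θ D h g) (hu : IsProfile p D h g b u) :
    Antitone (totalFlux p D h b u) := fun ξ η hξη =>
  le_of_deriv_nonpos_of_finite_values (S := {0, b + convFlux h 1}) (by simp) hξη
    (hu.totalFlux_cont hc).continuousOn fun x _ hx =>
      ⟨_, hu.totalFlux_hasDerivAt hc ((hu.totalFlux_mem_interior_or x).resolve_right hx),
        neg_nonpos.2 (g_nonneg hc (hu.mem_Icc x))⟩

theorem diffFlux_tendsto_atBot (hu : IsProfile p D h g b u) :
    Tendsto (diffFlux p D u) atBot (𝓝 0) :=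
  hu.flux_one.comp (tendsto_comap_iff.2 hu.tendsto_atBot : Tendsto id atBot (comap u (𝓝 1)))

theorem comp_tendsto (hu : IsProfile p D h g b u) {l : Filter ℝ} {a : ℝ} {F : ℝ → ℝ}
    (hF : ContinuousOn F (Icc 0 1)) (ha : a ∈ Icc (0 : ℝ) 1) (hl : Tendsto u l (𝓝 a)) :
    Tendsto (fun ξ => F (u ξ)) l (𝓝 (F a)) :=
  (hF a ha).tendsto.comp (tendsto_nhdsWithin_iff.2 ⟨hl, .of_forall hu.mem_Icc⟩)

theorem totalFlux_tendsto_atBot (hc : Coeffs p θ D h g) (hu : IsProfile p D h g b u) :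
    Tendsto (totalFlux p D h b u) atBot (𝓝 (b + convFlux h 1)) := by
  have h1 := hu.diffFlux_tendsto_atBot.add ((hu.tendsto_atBot.const_mul b).add
    (hu.comp_tendsto hc.convFlux_cont (right_mem_Icc.2 zero_le_one) hu.tendsto_atBot))
  rw [mul_one, zero_add] at h1
  exact h1

theorem totalFlux_tendsto_atTop (hc : Coeffs p θ D h g) (hu : IsProfile p D h g b u) :
    Tendsto (totalFlux p D h b u) atTop (𝓝 0) := by
  have h0 : Tendsto (diffFlux p D u) atTop (𝓝 0) :=
    hu.flux_zero.comp (tendsto_comap_iff.2 hu.tendsto_atTop : Tendsto id atTop (comap u (𝓝 0)))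
  have h1 := h0.add ((hu.tendsto_atTop.const_mul b).add
    (hu.comp_tendsto hc.convFlux_cont (left_mem_Icc.2 zero_le_one) hu.tendsto_atTop))
  rw [mul_zero, zero_add, zero_add, Coeffs.convFlux_zero] at h1
  exact h1

/-- Before reaching the equilibrium `1`, a profile is equal to `1`. -/
theorem eq_one_of_le (hc : Coeffs p θ D h g) (hu : IsProfile p D h g b u) {ξ η : ℝ}
    (hξ : u ξ = 1) (hηξ : η ≤ ξ) : u η = 1 := by
  have hanti := hu.totalFlux_antitone hc
  have hξE : totalFlux p D h b u ξ = b + convFlux h 1 := by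
    rcases hu.mem_interior_or ξ with h1 | ⟨-, h2⟩
    · exact absurd hξ h1.2.ne
    · rw [totalFlux, h2, hξ]
      ring
  -- At `ξ` the nonincreasing total flux still has its limit at `-∞`, so it is constant before `ξ`.
  -- Levels in `(θ,1)`, where its derivative is `-g < 0`, are therefore excluded, and `u` cannot
  -- leave `1`.
  have hconst : ∀ t ≤ ξ, totalFlux p D h b u t = b + convFlux h 1 := fun t ht =>
    le_antisymm (hanti.ge_of_tendsto (hu.totalFlux_tendsto_atBot hc) t) (hξE ▸ hanti ht)
  have hnot : ∀ t < ξ, u t ∉ Ioo θ 1 := fun t ht htu => by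
    have htI : t ∈ interiorSet u := ⟨hc.mem_Ioo.1.trans htu.1, htu.2⟩
    obtain ⟨s, hs1, hs2⟩ := ((eventually_lt_left_of_deriv_neg (hu.totalFlux_hasDerivAt hc htI)
      (neg_lt_zero.2 (hc.g_pos _ htu))).and self_mem_nhdsWithin).exists
    rw [hconst t ht.le, hconst s (le_of_lt (lt_trans hs2 ht))] at hs1
    exact hs1.false
  by_contra hne
  have hlt : u η < 1 := lt_of_le_of_ne (hu.mem_Icc η).2 hne
  obtain ⟨s, hs1, hs2⟩ := exists_between (max_lt hlt hc.mem_Ioo.2)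
  obtain ⟨t, ht, hts⟩ := intermediate_value_Icc hηξ hu.continuous.continuousOn
    (show s ∈ Icc (u η) (u ξ) from ⟨((le_max_left _ _).trans_lt hs1).le, hξ ▸ hs2.le⟩)
  have htξ : t < ξ := lt_of_le_of_ne ht.2 (by rintro rfl; linarith)
  exact hnot t htξ (hts ▸ ⟨(le_max_right _ _).trans_lt hs1, hs2⟩)

/-- The first passage of a level. -/
theorem exists_first_passage (hu : IsProfile p D h g b u) {s : ℝ} (hs : s ∈ Ioo (0 : ℝ) 1) :
    ∃ α, u α = s ∧ ∀ ξ < α, s < u ξ := by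
  have hcl : IsClosed {ξ | u ξ ≤ s} := isClosed_le hu.continuous continuous_const
  obtain ⟨N, hN⟩ := eventually_atBot.1 (hu.tendsto_atBot.eventually (lt_mem_nhds hs.2))
  obtain ⟨M, hM⟩ := (hu.tendsto_atTop.eventually (gt_mem_nhds hs.1)).exists
  have hbdd : BddBelow {ξ | u ξ ≤ s} := ⟨N, fun ξ hξ => by
    by_contra! hlt
    exact (hN ξ hlt.le).not_ge hξ⟩
  have hmem := hcl.csInf_mem ⟨M, le_of_lt hM⟩ hbdd
  have hbefore : ∀ ξ < sInf {ξ | u ξ ≤ s}, s < u ξ := fun ξ hξ => by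
    by_contra! hle
    exact hξ.not_ge (csInf_le hbdd hle)
  refine ⟨_, le_antisymm hmem ?_, hbefore⟩
  refine ge_of_tendsto (hu.continuous.continuousAt.tendsto.mono_left
    (nhdsWithin_le_nhds (s := Iio (sInf {ξ | u ξ ≤ s})))) ?_
  filter_upwards [self_mem_nhdsWithin] with ξ hξ using (hbefore ξ hξ).le

/-- Above the ignition level a profile decreases strictly. -/
theorem diffFlux_neg_of_mem (hc : Coeffs p θ D h g) (hu : IsProfile p D h g b u) {ξ : ℝ}
    (hξ : u ξ ∈ Ioo θ 1) : diffFlux p D u ξ < 0 := by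
  by_contra! hpos
  have hI : u ξ ∈ Ioo (0 : ℝ) 1 := ⟨hc.mem_Ioo.1.trans hξ.1, hξ.2⟩
  obtain ⟨α, hα, hbefore⟩ := hu.exists_first_passage hI
  have hαξ : α ≤ ξ := not_lt.1 fun hlt => (hbefore ξ hlt).false
  have hαI : α ∈ interiorSet u := by
    change u α ∈ Ioo (0 : ℝ) 1
    rwa [hα]
  have hdα : deriv u α ≤ 0 := by
    by_contra! hlt
    obtain ⟨t, ht1, ht2⟩ := ((eventually_lt_left_of_deriv_neg (hu.hasDerivAt hαI).neg
      (neg_lt_zero.2 hlt)).and self_mem_nhdsWithin).exists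
    have := hbefore t ht2
    simp only [Pi.neg_apply] at ht1
    linarith
  have hφα : diffFlux p D u α ≤ 0 :=
    not_lt.1 fun hlt => hdα.not_gt ((diffFlux_pos_iff hc hαI).1 hlt)
  have hgpos := hc.g_pos _ hξ
  rcases hαξ.eq_or_lt with rfl | hlt
  -- If the flux is not negative at the first passage itself, then it vanishes there with derivative
  -- `-g < 0`; it is positive just before, so `u` rises to the level from below.
  · have hd0 : deriv u α = 0 :=
      le_antisymm hdα (not_lt.1 fun hlt => hpos.not_gt ((diffFlux_neg_iff hc hαI).2 hlt))
    have hφd := hu.diffFlux_hasDerivAt hαI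
    rw [hd0, mul_zero, zero_sub] at hφd
    have h1 := eventually_lt_left_of_deriv_neg hφd (neg_lt_zero.2 hgpos)
    have h2 : ∀ᶠ t in 𝓝[<] α, t ∈ interiorSet u :=
      nhdsWithin_le_nhds ((isOpen_interiorSet hu.continuous).mem_nhds hαI)
    obtain ⟨l, hl, hIoo⟩ := (mem_nhdsLT_iff_exists_Ioo_subset).1 (h1.and h2)
    obtain ⟨t, ht1, ht2⟩ := exists_between (show l < α from hl)
    have hmono : StrictMonoOn u (Icc t α) :=
      strictMonoOn_of_deriv_pos (convex_Icc _ _) hu.continuous.continuousOn fun s hs => by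
        rw [interior_Icc] at hs
        have h3 := hIoo ⟨ht1.trans hs.1, hs.2⟩
        exact (diffFlux_pos_iff hc h3.2).1 (hpos.trans_lt h3.1)
    have h4 := hmono (left_mem_Icc.2 ht2.le) (right_mem_Icc.2 ht2.le) ht2
    linarith [hbefore t ht2]
  -- At a later passage of the same level with nonnegative flux, the total flux would be at least
  -- its value at `α`, although it drops strictly right after `α`.
  · obtain ⟨t, ht1, ht2⟩ := ((eventually_lt_right_of_deriv_neg (hu.totalFlux_hasDerivAt hc hαI)
      (by rw [hα]; exact neg_lt_zero.2 hgpos)).and (Ioo_mem_nhdsGT hlt)).exists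
    have h5 := hu.totalFlux_antitone hc ht2.2.le
    have h6 : totalFlux p D h b u α ≤ totalFlux p D h b u ξ := by
      rw [totalFlux, totalFlux, hα]
      linarith
    linarith

/-- After its first passage of the ignition level, a profile stays below it. -/
theorem le_of_first_passage (hc : Coeffs p θ D h g) (hu : IsProfile p D h g b u) {α ξ : ℝ}
    (hα : u α = θ) (hξ : α ≤ ξ) : u ξ ≤ θ := by
  have h1 := le_add_of_deriv_le_above (m := θ) (κ := 0) hξ le_rfl hu.continuous.continuousOn hα.le
    (fun x hx hx' => by
      have hx1 : u x < 1 := lt_of_le_of_ne (hu.mem_Icc x).2 fun h1 => by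
        have := hu.eq_one_of_le hc h1 hx.1.le
        linarith [hc.mem_Ioo.2]
      have hxI : x ∈ interiorSet u := ⟨hc.mem_Ioo.1.trans hx', hx1⟩
      exact ⟨_, hu.hasDerivAt hxI,
        ((diffFlux_neg_iff hc hxI).1 (hu.diffFlux_neg_of_mem hc ⟨hx', hx1⟩)).le⟩)
  linarith

/-- After the first passage of the ignition level, the total flux vanishes. -/
theorem diffFlux_of_first_passage (hc : Coeffs p θ D h g) (hu : IsProfile p D h g b u) {α ξ : ℝ}
    (hα : u α = θ) (hξ : α ≤ ξ) : diffFlux p D u ξ = -(b * u ξ + convFlux h (u ξ)) := by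
  -- Below `θ` the reaction is absent, so the total flux is constant, equal to its limit `0` at
  -- `+∞`.
  have hconst : ∀ η ≥ ξ, totalFlux p D h b u η = totalFlux p D h b u ξ := fun η hη => by
    refine le_antisymm (hu.totalFlux_antitone hc hη) (neg_le_neg_iff.1 ?_)
    refine le_of_deriv_nonpos_of_finite_values (E := fun ξ => -totalFlux p D h b u ξ)
      (S := {0, -(b + convFlux h 1)}) (by simp) hη (hu.totalFlux_cont hc).neg.continuousOn
      fun x hx hxS => ?_
    have hxI := (hu.totalFlux_mem_interior_or x).resolve_right (by
      simp only [mem_insert_iff, mem_singleton_iff, neg_eq_zero, neg_inj] at hxS ⊢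
      exact hxS)
    refine ⟨_, (hu.totalFlux_hasDerivAt hc hxI).neg, ?_⟩
    rw [hc.g_zero _ ⟨(hu.mem_Icc x).1, hu.le_of_first_passage hc hα (hξ.trans hx.1.le)⟩]
    simp
  have h1 : totalFlux p D h b u ξ = 0 := tendsto_nhds_unique
    (tendsto_const_nhds.congr' (by
      filter_upwards [eventually_ge_atTop ξ] with η hη using (hconst η hη).symm))
    (hu.totalFlux_tendsto_atTop hc)
  rw [totalFlux] at h1
  linarith

/-! ### Comparison of an arbitrary profile with the front flux. -/

/-- The difference between a front flux and the flux of a profile, along the profile. -/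
theorem flux_gap_hasDerivAt (hc : Coeffs p θ D h g) (hu : IsProfile p D h g b u)
    (hV : IsFrontFlux p D h g c V) {ξ : ℝ} (hξ : u ξ ∈ Ioo θ 1) :
    HasDerivAt (fun ξ => V (u ξ) + diffFlux p D u ξ)
      ((c - b) * deriv u ξ + g (u ξ) *
        (V (u ξ) ^ (-(conj p - 1)) * (-diffFlux p D u ξ) ^ (conj p - 1) - 1)) ξ := by
  have hI : ξ ∈ interiorSet u := ⟨hc.mem_Ioo.1.trans hξ.1, hξ.2⟩
  have hφ := hu.diffFlux_neg_of_mem hc hξ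
  have hu' := (diffFlux_neg_iff hc hI).1 hφ
  refine (((hV.deriv (u ξ) hI).comp ξ (hu.hasDerivAt hI)).add
    (hu.diffFlux_hasDerivAt hI)).congr_deriv ?_
  have h1 := rate_of_flux hc.one_lt (hc.D_pos _ hI) hu'
  rw [← diffFlux_of_mem hI] at h1
  have h2 := reaction_mul_rpow hc hI (neg_pos.2 hφ) (V (u ξ) ^ (-(conj p - 1)))
  rw [h1] at h2
  linarith

theorem flux_gap_cont (hu : IsProfile p D h g b u) (hV : IsFrontFlux p D h g c V) :
    Continuous fun ξ => V (u ξ) + diffFlux p D u ξ :=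
  (hV.cont.comp_continuous hu.continuous hu.mem_Icc).add hu.flux_continuous

theorem flux_gap_tendsto (hu : IsProfile p D h g b u) (hV : IsFrontFlux p D h g c V) :
    Tendsto (fun ξ => V (u ξ) + diffFlux p D u ξ) atBot (𝓝 0) := by
  have h1 := (hu.comp_tendsto hV.cont (right_mem_Icc.2 zero_le_one) hu.tendsto_atBot).add
    hu.diffFlux_tendsto_atBot
  rwa [hV.one, zero_add] at h1

theorem mem_Ioo_of_flux_gap_ne (hu : IsProfile p D h g b u) (hV : IsFrontFlux p D h g c V)
    {ξ : ℝ} (hξ : θ < u ξ) (hθ : 0 < θ) (hne : V (u ξ) + diffFlux p D u ξ ≠ 0) :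
    u ξ ∈ Ioo θ 1 := by
  refine ⟨hξ, ?_⟩
  rcases hu.mem_interior_or ξ with h1 | ⟨h1 | h1, h2⟩
  · exact h1.2
  · linarith
  · exact absurd (by rw [h1, h2, hV.one, zero_add]) hne

/-- The gap vanishes at `-∞`. Where it is positive, minus the flux is below `V`, so the reaction
bracket is nonpositive; `(c - b) u' ≤ 0` as well, hence the gap cannot grow. -/
theorem flux_gap_nonpos (hc : Coeffs p θ D h g) (hu : IsProfile p D h g b u)
    (hV : IsFrontFlux p D h g c V) (hbc : b ≤ c) {α ξ : ℝ} (hα : ∀ t < α, θ < u t)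
    (hξ : ξ ≤ α) : V (u ξ) + diffFlux p D u ξ ≤ 0 := by
  refine nonpos_of_tendsto_atBot (hu.flux_gap_cont hV).continuousOn (hu.flux_gap_tendsto hV)
    (fun t ht ht0 => ?_) hξ
  have htI := hu.mem_Ioo_of_flux_gap_ne hV (hα t ht) hc.mem_Ioo.1 ht0.ne'
  have htI' : t ∈ interiorSet u := ⟨hc.mem_Ioo.1.trans htI.1, htI.2⟩
  refine ⟨_, hu.flux_gap_hasDerivAt hc hV htI, ?_⟩
  have hφ := hu.diffFlux_neg_of_mem hc htI
  have h1 := mul_nonpos_of_nonneg_of_nonpos (sub_nonneg.2 hbc)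
    ((diffFlux_neg_iff hc htI').1 hφ).le
  have hV0 := hV.pos _ htI'
  have h2 : V (u t) ^ (-(conj p - 1)) * (-diffFlux p D u t) ^ (conj p - 1) ≤ 1 := by
    rw [Real.rpow_neg hV0.le, inv_mul_le_one₀ (Real.rpow_pos_of_pos hV0 _)]
    exact Real.rpow_le_rpow (by linarith) (by linarith) (by linarith [hc.conj_gt])
  have h3 := mul_nonpos_of_nonneg_of_nonpos (hc.g_pos _ htI).le (sub_nonpos.2 h2)
  linarith

theorem flux_gap_nonneg (hc : Coeffs p θ D h g) (hu : IsProfile p D h g b u)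
    (hV : IsFrontFlux p D h g c V) (hbc : c ≤ b) {α ξ : ℝ} (hα : ∀ t < α, θ < u t)
    (hξ : ξ ≤ α) : 0 ≤ V (u ξ) + diffFlux p D u ξ := by
  refine neg_nonpos.1 (nonpos_of_tendsto_atBot (w := fun ξ => -(V (u ξ) + diffFlux p D u ξ))
    (hu.flux_gap_cont hV).neg.continuousOn
    (by simpa using (hu.flux_gap_tendsto hV).neg) (fun t ht ht0 => ?_) hξ)
  have htI := hu.mem_Ioo_of_flux_gap_ne hV (hα t ht) hc.mem_Ioo.1 (neg_pos.1 ht0).ne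
  have htI' : t ∈ interiorSet u := ⟨hc.mem_Ioo.1.trans htI.1, htI.2⟩
  refine ⟨_, (hu.flux_gap_hasDerivAt hc hV htI).neg, ?_⟩
  have hφ := hu.diffFlux_neg_of_mem hc htI
  have h1 := mul_nonneg_of_nonpos_of_nonpos (sub_nonpos.2 hbc)
    ((diffFlux_neg_iff hc htI').1 hφ).le
  have hV0 := hV.pos _ htI'
  have h2 : 1 ≤ V (u t) ^ (-(conj p - 1)) * (-diffFlux p D u t) ^ (conj p - 1) := by
    rw [Real.rpow_neg hV0.le, ← div_eq_inv_mul, one_le_div (Real.rpow_pos_of_pos hV0 _)]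
    exact Real.rpow_le_rpow hV0.le (by linarith) (by linarith [hc.conj_gt])
  have h3 := mul_nonneg (hc.g_pos _ htI).le (sub_nonneg.2 h2)
  linarith

/-- Any profile has the speed of the front flux. -/
theorem speed_eq (hc : Coeffs p θ D h g) (hu : IsProfile p D h g b u)
    (hV : IsFrontFlux p D h g c V) (hVθ : ∀ s ≤ θ, V s = c * s + convFlux h s) : b = c := by
  obtain ⟨α, hα, hbefore⟩ := hu.exists_first_passage hc.mem_Ioo
  have h1 := hu.diffFlux_of_first_passage hc hα le_rfl
  have h2 := hVθ θ le_rfl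
  have hθ := hc.mem_Ioo.1
  -- At the first passage of `θ` the gap equals `(c - b) θ`, while the comparison gives it the
  -- opposite sign to `c - b`.
  rcases le_total b c with hbc | hbc
  · have h3 := hu.flux_gap_nonpos hc hV hbc hbefore le_rfl
    rw [h1, hα, h2] at h3
    exact le_antisymm hbc (le_of_mul_le_mul_right (by linarith) hθ)
  · have h3 := hu.flux_gap_nonneg hc hV hbc hbefore le_rfl
    rw [h1, hα, h2] at h3
    exact le_antisymm (le_of_mul_le_mul_right (by linarith) hθ) hbc

/-- Any profile has the front flux as its flux. -/
theorem diffFlux_eq (hc : Coeffs p θ D h g) (hu : IsProfile p D h g c u)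
    (hV : IsFrontFlux p D h g c V) (hVθ : ∀ s ≤ θ, V s = c * s + convFlux h s) (ξ : ℝ) :
    diffFlux p D u ξ = -V (u ξ) := by
  obtain ⟨α, hα, hbefore⟩ := hu.exists_first_passage hc.mem_Ioo
  rcases le_total ξ α with h1 | h1
  · have h2 := hu.flux_gap_nonpos hc hV le_rfl hbefore h1
    have h3 := hu.flux_gap_nonneg hc hV le_rfl hbefore h1
    linarith
  · rw [hu.diffFlux_of_first_passage hc hα h1, hVθ _ (hu.le_of_first_passage hc hα h1)]

theorem deriv_eq (hc : Coeffs p θ D h g) (hu : IsProfile p D h g c u)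
    (hV : IsFrontFlux p D h g c V) (hVθ : ∀ s ≤ θ, V s = c * s + convFlux h s) {ξ : ℝ}
    (hξ : ξ ∈ interiorSet u) : deriv u ξ = -decayRate p D V (u ξ) := by
  have h0 := hu.diffFlux_eq hc hV hVθ ξ
  have h1 : deriv u ξ < 0 := (diffFlux_neg_iff hc hξ).1 (by linarith [hV.pos _ hξ])
  have h2 := rate_of_flux hc.one_lt (hc.D_pos _ hξ) h1
  rw [← diffFlux_of_mem hξ, h0, neg_neg] at h2
  rw [decayRate, h2, neg_neg]

/-- After reaching the equilibrium `0`, a profile is equal to `0`. -/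
theorem eq_zero_of_le (hc : Coeffs p θ D h g) (hu : IsProfile p D h g c u)
    (hV : IsFrontFlux p D h g c V) (hVθ : ∀ s ≤ θ, V s = c * s + convFlux h s) {ξ η : ℝ}
    (hξ : u ξ = 0) (hξη : ξ ≤ η) : u η = 0 := by
  refine le_antisymm ?_ (hu.mem_Icc η).1
  have h1 := le_add_of_deriv_le_above (m := 0) (κ := 0) hξη le_rfl
    hu.continuous.continuousOn hξ.le (fun x hx hx' => by
      have hx1 : u x < 1 := lt_of_le_of_ne (hu.mem_Icc x).2 fun h1 => by
        have := hu.eq_one_of_le hc h1 hx.1.le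
        linarith
      refine ⟨_, hu.hasDerivAt ⟨hx', hx1⟩, ?_⟩
      rw [hu.deriv_eq hc hV hVθ ⟨hx', hx1⟩]
      exact neg_nonpos.2 (decayRate_pos hc hV ⟨hx', hx1⟩).le)
  linarith

/-- Any profile is a translate of the profile built from the front flux. -/
theorem exists_translation (hc : Coeffs p θ D h g) (hu : IsProfile p D h g c u)
    (hV : IsFrontFlux p D h g c V) (hVθ : ∀ s ≤ θ, V s = c * s + convFlux h s) :
    ∃ τ, ∀ ξ, u ξ = profileOf (arrivalTime p D V) (ξ + τ) := by
  have hT := arrivalTime_strictAnti hc hV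
  have hconn : OrdConnected (interiorSet u) := ⟨fun ξ hξ η hη t ht => by
    rcases hu.mem_interior_or t with h1 | ⟨h1 | h1, -⟩
    · exact h1
    · exact absurd (hu.eq_zero_of_le hc hV hVθ h1 ht.2) hη.1.ne'
    · exact absurd (hu.eq_one_of_le hc h1 ht.1) hξ.2.ne⟩
  -- Separation of variables: the arrival time of the current level differs from `ξ` by a constant,
  -- `interiorSet u` being an interval.
  have hd : ∀ ξ ∈ interiorSet u,
      HasDerivAt (fun ξ => arrivalTime p D V (u ξ) - ξ) 0 ξ := fun ξ hξ => by
    refine (((arrivalTime_deriv hc hV hξ).comp ξ (hu.hasDerivAt hξ)).sub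
      (hasDerivAt_id ξ)).congr_deriv ?_
    rw [hu.deriv_eq hc hV hVθ hξ, neg_mul_neg, inv_mul_cancel₀ (decayRate_pos hc hV hξ).ne',
      sub_self]
  obtain ⟨ξ₀, hξ₀, -⟩ := hu.exists_first_passage hc.mem_Ioo
  have hξ₀I : ξ₀ ∈ interiorSet u := by
    change u ξ₀ ∈ Ioo (0 : ℝ) 1
    rw [hξ₀]
    exact hc.mem_Ioo
  have hconst : ∀ ξ ∈ interiorSet u,
      arrivalTime p D V (u ξ) = ξ + (arrivalTime p D V (u ξ₀) - ξ₀) := fun ξ hξ => by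
    have := (isOpen_interiorSet hu.continuous).is_const_of_deriv_eq_zero hconn.isPreconnected
      (fun t ht => (hd t ht).differentiableAt.differentiableWithinAt)
      (fun t ht => (hd t ht).deriv) hξ hξ₀I
    linarith
  refine ⟨arrivalTime p D V (u ξ₀) - ξ₀, fun ξ => ?_⟩
  rcases hu.mem_interior_or ξ with hξ | ⟨hξ | hξ, -⟩
  · rw [← hconst ξ hξ, profileOf_apply hT hξ]
  -- Once `u = 0`, each level in `(0,1)` has been passed, so no arrival time exceeds the shifted
  -- `ξ`.
  · rw [hξ, profileOf_eq_zero]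
    intro s hs
    obtain ⟨η, hη, -⟩ := hu.exists_first_passage hs
    have hηξ : η ≤ ξ := not_lt.1 fun hlt => by
      have := hu.eq_zero_of_le hc hV hVθ hξ hlt.le
      linarith [hs.1]
    have := hconst η (by change u η ∈ Ioo (0 : ℝ) 1; rwa [hη])
    rw [hη] at this
    linarith
  · rw [hξ, profileOf_eq_one]
    intro s hs
    obtain ⟨η, hη, -⟩ := hu.exists_first_passage hs
    have hηξ : ξ < η := not_le.1 fun hle => by
      have := hu.eq_one_of_le hc hξ hle
      linarith [hs.2]
    have := hconst η (by change u η ∈ Ioo (0 : ℝ) 1; rwa [hη])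
    rw [hη] at this
    linarith

end IsProfile

/-! ### Assembly of the theorem. -/

theorem hMin_pos (hc : Coeffs p θ D h g) : 0 < hMin h := by
  obtain ⟨x, hx, hmin⟩ := isCompact_Icc.exists_isMinOn (nonempty_Icc.2 zero_le_one) hc.h_cont
  refine (hc.h_pos x hx).trans_le (le_csInf ((nonempty_Icc.2 zero_le_one).image h) ?_)
  rintro _ ⟨y, hy, rfl⟩
  exact hmin hy

theorem exists_isUniqueWaveSpeed (hc : Coeffs p θ D h g)
    (hH : convFlux h 1 ^ conj p ≤ ∫ u in θ..1, reaction p D g u) :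
    ∃ c, IsUniqueWaveSpeed p D h g c ∧ 0 < c := by
  obtain ⟨c, V, hc0, hV, hVθ⟩ := hc.exists_frontFlux hH
  refine ⟨c, ⟨⟨_, isProfile_profileOf hc hV⟩, fun u v hu hv => ?_,
    fun b u hu => hu.speed_eq hc hV hVθ⟩, hc0⟩
  obtain ⟨τ, hτ⟩ := hu.exists_translation hc hV hVθ
  obtain ⟨σ, hσ⟩ := hv.exists_translation hc hV hVθ
  refine ⟨σ - τ, fun ξ => ?_⟩
  rw [hσ, hτ]
  congr 1
  ring

end TravelingWave

end
theorem theorem3 (p θ : ℝ) (D h g : ℝ → ℝ)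
    (hp : 1 < p) (hθ : θ ∈ Set.Ioo (0 : ℝ) 1)
    (hD : ContDiffOn ℝ 1 D (Set.Ioo 0 1)) (hDpos : ∀ u ∈ Set.Ioo (0 : ℝ) 1, 0 < D u)
    (hh : ContinuousOn h (Set.Icc 0 1))
    (hg : ContinuousOn g (Set.Icc 0 1))
    (hg_zero : ∀ u ∈ Set.Icc 0 θ, g u = 0) (hg_pos : ∀ u ∈ Set.Ioo θ 1, 0 < g u)
    (hg_one : g 1 = 0)
    (hint : IntervalIntegrable (fun u => D u ^ (TravelingWave.conj p - 1) * g u)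
      MeasureTheory.volume 0 1)
    (hh_pos : ∀ u ∈ Set.Icc (0 : ℝ) 1, 0 < h u)
    (hH : TravelingWave.convFlux h 1 ≤
      (TravelingWave.kConst p *
        ∫ u in (0 : ℝ)..1, D u ^ (TravelingWave.conj p - 1) * g u)
          ^ (1 / TravelingWave.conj p)) :
    ∃ c : ℝ, TravelingWave.IsUniqueWaveSpeed p D h g c ∧
      0 < c ∧ -TravelingWave.hMin h < 0 := by
  have hc : TravelingWave.Coeffs p θ D h g :=
    ⟨hp, hθ, hD.continuousOn, hDpos, hh, hh_pos, hg, hg_zero, hg_pos, hg_one, hint⟩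
  have hq : 0 < TravelingWave.conj p := by linarith [hc.conj_gt]
  obtain ⟨hk0, hk1⟩ := TravelingWave.kConst_nonneg_and_le_one hp
  have hI := hc.integral_pos
  -- Raise the assumption to the power `p'` and drop `k(p) ≤ 1`; the integral over `[0,θ]` is zero.
  have hH' : TravelingWave.convFlux h 1 ^ TravelingWave.conj p ≤
      ∫ u in θ..1, TravelingWave.reaction p D g u := by
    have h1 := Real.rpow_le_rpow (hc.convFlux_pos (right_mem_Ioc.2 zero_lt_one)).le hH hq.le
    change _ ≤ ((_ * ∫ u in (0 : ℝ)..1, TravelingWave.reaction p D g u) ^ _) ^ _ at h1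
    rw [hc.integral_eq, ← Real.rpow_mul (by positivity), one_div_mul_cancel hq.ne',
      Real.rpow_one] at h1
    exact h1.trans (mul_le_of_le_one_left hI.le hk1)
  obtain ⟨c, h1, h2⟩ := TravelingWave.exists_isUniqueWaveSpeed hc hH'
  exact ⟨c, h1, h2, neg_lt_zero.2 (TravelingWave.hMin_pos hc)⟩
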